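/- Let $U\subset\mathbb R^2$ be an open set and let $h=(h_1,h_2)\in BV(U,\mathbb R^2)$ be continuous on $U$; that is, $h\in L^1(U,\mathbb R^2)$ and the distributional partial derivatives $D_jh_i$ $(i,j\in\{1,2\})$ are finite signed Radon measures on $U$. Let $\nabla h$ denote the approximate gradient of $h$, i.e. the matrix whose $(i,j)$ entry is the density (with respect to Lebesgue measure) of the absolutely continuous part of $D_jh_i$, and let $J_h=\det\nabla h$. Let $h_\varepsilon$ be the standard mollifications of $h$, and suppose that the distributional Jacobian $$\operatorname{Det} Dh=\lim_{\varepsilon\to0+}\det\nabla h_\varepsilon\qquad\text{(limit in the sense of distributions on }U)$$ is a finite signed Radon measure on $U$. Then the density, with respect to Lebesgue measure, of the absolutely continuous part of $\operatorname{Det} Dh$ equals $J_h(x)$ for a.e. $x\in U$. -/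

import Mathlib

open MeasureTheory Set Filter Topology TopologicalSpace
open scoped Distributions Convolution

noncomputable section

/-- The Euclidean plane. -/
abbrev Plane : Type := EuclideanSpace ℝ (Fin 2)

/-- `ν ∈ 𝓜(U)`: finite signed Radon measures on the open set `U` are represented by the finite
signed Borel measures on the plane that vanish outside `U` (on an open subset of the plane every
finite signed Borel measure is Radon). -/
def IsMeasureOn (U : Opens Plane) (ν : SignedMeasure Plane) : Prop :=
  ∀ A : Set Plane, MeasurableSet A → Disjoint A (U : Set Plane) → ν A = 0

/-- The finite signed measure `ν` on `U` is the distributional partial derivative `D_j u` of the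
scalar function `u` on `U`:  `∫_U u ∂_j φ dx = - ∫ φ dν` for all `φ ∈ 𝓓(U)`. -/
def IsPartialDerivMeasure (U : Opens Plane) (u : Plane → ℝ) (j : Fin 2)
    (ν : SignedMeasure Plane) : Prop :=
  IsMeasureOn U ν ∧
    ∀ φ : 𝓓(U, ℝ),
      ∫ x in (U : Set Plane), u x * fderiv ℝ φ x (EuclideanSpace.single j 1) = - ∫ᵛ x, φ x ∂•ν

/-- `h ∈ BV(U, ℝ²)`: `h` is integrable on `U` and all its first order distributional partial
derivatives `D_j h_i` are finite signed measures on `U`. -/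
def MemBV (U : Opens Plane) (h : Plane → Plane) : Prop :=
  IntegrableOn h (U : Set Plane) volume ∧
    ∀ i j : Fin 2, ∃ ν : SignedMeasure Plane, IsPartialDerivMeasure U (fun x => h x i) j ν

open Classical in
/-- The signed measure `D_j h_i` on `U` (it is uniquely determined; junk value `0` if there is no
such measure, that is, if `h` is not `BV`). -/
def derivMeasure (U : Opens Plane) (h : Plane → Plane) (i j : Fin 2) : SignedMeasure Plane :=
  if H : ∃ ν : SignedMeasure Plane, IsPartialDerivMeasure U (fun x => h x i) j ν
  then H.choose else 0

theorem MemBV.isPartialDerivMeasure {U : Opens Plane} {h : Plane → Plane} (hh : MemBV U h)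
    (i j : Fin 2) :
    IsPartialDerivMeasure U (fun x => h x i) j (derivMeasure U h i j) := by
  have H := hh.2 i j
  rw [derivMeasure, dif_pos H]
  exact H.choose_spec

/-- The approximate gradient `∇h` of a `BV` map: the matrix of the densities, with respect to
Lebesgue measure, of the absolutely continuous parts of the measures `D_j h_i`. -/
def approxGradient (U : Opens Plane) (h : Plane → Plane) (x : Plane) :
    Matrix (Fin 2) (Fin 2) ℝ :=
  Matrix.of fun i j => (derivMeasure U h i j).rnDeriv volume x

/-- The pointwise Jacobian `J_h = det ∇h`. -/
def pointwiseJacobian (U : Opens Plane) (h : Plane → Plane) (x : Plane) : ℝ :=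
  (approxGradient U h x).det

/-- The standard mollifier `c · exp (-1 / (1 - |x|²))` on the unit disc, `0` elsewhere, normalized
to have integral `1`. -/
def standardMollifier (x : Plane) : ℝ :=
  expNegInvGlue (1 - ‖x‖ ^ 2) / ∫ y : Plane, expNegInvGlue (1 - ‖y‖ ^ 2)

/-- The rescaled mollifier `ε⁻² ρ(x / ε)`, supported in the closed disc of radius `ε`. -/
def scaledMollifier (ε : ℝ) (x : Plane) : ℝ :=
  (ε ^ 2)⁻¹ * standardMollifier (ε⁻¹ • x)

/-- The standard mollification `h_ε(x) = ∫ ρ_ε(y) h(x - y) dy`, where `h` is extended by `0`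
outside `U`. At points of `U` whose distance to the complement of `U` is more than `ε`, the values
of `h` outside `U` play no role. -/
def mollification (U : Opens Plane) (h : Plane → Plane) (ε : ℝ) : Plane → Plane :=
  scaledMollifier ε ⋆[ContinuousLinearMap.lsmul ℝ ℝ, volume] (U : Set Plane).indicator h

/-- The distributional Jacobian `Det Dh = lim_{ε → 0+} det ∇h_ε` (limit in the sense of
distributions on `U`) is the finite signed Radon measure `μ` on `U`. -/
def HasDistribJacobian (U : Opens Plane) (h : Plane → Plane) (μ : SignedMeasure Plane) : Prop :=
  IsMeasureOn U μ ∧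
    ∀ φ : 𝓓(U, ℝ),
      Tendsto
        (fun ε : ℝ => ∫ x in (U : Set Plane), φ x * (fderiv ℝ (mollification U h ε) x).det)
        (𝓝[>] 0) (𝓝 (∫ᵛ x, φ x ∂•μ))

end

open Metric
open scoped ENNReal ContDiff

/-! At almost every `x₀ ∈ U`, with `L = ∇h(x₀)` and `d` the density of `Det Dh` at `x₀`, the
measures `D_j h_i - L_ij dx` and `Det Dh - d dx` have mass `o(r²)` on the ball of radius `r`. It
remains to show that `d = det L` at each such point.

Fix `η` and a small `r` for which these masses are at most `η r²`. Cut the region between the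
squares of half sides `r` and `2r` into `N` layers; one of them carries at most the fraction `1/N`
of the mass, that is, `O(η r s)` where `s ~ r/N` is its width. Let `w = h_ε - L x` and let `φ` be a
cut-off equal to `1` inside the layer and `0` outside it, with `|∇φ| ≤ C/s`. Expanding `det (L +
∇w)` gives `det L`, terms linear in `∇w`, which contribute `O(η r²)`, and `det ∇w`. As the Jacobian
is a null Lagrangian, `∫ φ det ∇w` is an integral of `(w₀ - c) ∇φ × ∇w₁` over the layer, hence at
most `osc(w₀) · (C/s) · O(η r s)`.

The oscillation of `w₀` on the layer is `O(η r)`: along the layer it is controlled by `∫ |∇w₀|` on a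
well-chosen line, and across it by the continuity of `h`, once `s` is small enough. The width `s`
cancels, so no rate is needed in the modulus of continuity. Letting `ε → 0` and dividing by `∫ φ ≥
r²` gives `|d - det L| = O(η)` for small `η`. The lemmas that carry this are
`ae_tendsto_deviationMeasure_div`, `exists_abs_sub_le_of_mem_squareFrame`,
`integral_mul_jacobian_eq` and `exists_abs_sub_det_le`. -/

noncomputable section

/-! ### Deviation of a signed measure from a constant density -/

/-- The measure `|ν_s| + |f - c| dx`, where `ν = ν_s + f dx` is the Lebesgue decomposition of `ν`.
It dominates the total variation of `ν - c dx`. -/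
def deviationMeasure (ν : SignedMeasure Plane) (c : ℝ) : Measure Plane :=
  (ν.singularPart volume).totalVariation +
    volume.withDensity (fun x => ‖ν.rnDeriv volume x - c‖ₑ)

theorem measurable_enorm_rnDeriv_sub (ν : SignedMeasure Plane) (c : ℝ) :
    Measurable fun x => ‖ν.rnDeriv volume x - c‖ₑ :=
  ((ν.measurable_rnDeriv volume).sub_const c).enorm

instance (ν : SignedMeasure Plane) (c : ℝ) : SFinite (deviationMeasure ν c) := by
  unfold deviationMeasure; infer_instance

/-- The measure `c dx` is not finite on the plane, so it is truncated to a ball containing the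
support of `φ`; the difference with `ν` is then a finite signed measure whose variation can be
estimated. -/
theorem enorm_integral_sub_le_deviationMeasure (ν : SignedMeasure Plane) (c : ℝ) {φ : Plane → ℝ}
    (hφ : Continuous φ) (hc : HasCompactSupport φ) :
    ‖(∫ᵛ x, φ x ∂•ν) - c * ∫ x, φ x‖ₑ ≤ ∫⁻ x, ‖φ x‖ₑ ∂(deviationMeasure ν c) := by
  obtain ⟨R, hR⟩ := hc.isCompact.isBounded.subset_closedBall (0 : Plane)
  set B := closedBall (0 : Plane) R with hB
  have hBm : MeasurableSet B := measurableSet_closedBall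
  have hφB : ∀ x, x ∉ B → φ x = 0 := fun x hx => image_eq_zero_of_notMem_tsupport fun h => hx (hR h)
  have : IsFiniteMeasure (volume.restrict B) :=
    ⟨by rw [Measure.restrict_apply_univ]; exact measure_closedBall_lt_top⟩
  set f := ν.rnDeriv volume
  have hf : Integrable f volume := ν.integrable_rnDeriv volume
  set g : Plane → ℝ := B.indicator fun _ => c
  have hg : Integrable g volume :=
    (integrable_indicator_iff hBm).2 (integrableOn_const measure_closedBall_lt_top.ne)
  set s := ν.singularPart volume
  have hdec : ν = s + volume.withDensityᵥ (f - g) + c • (volume.restrict B).toSignedMeasure := by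
    have h1 : volume.withDensityᵥ g = c • (volume.restrict B).toSignedMeasure := by
      ext A hA
      rw [withDensityᵥ_apply hg hA]
      simp only [_root_.smul_apply, Measure.toSignedMeasure_apply_measurable hA, g]
      rw [setIntegral_indicator hBm, setIntegral_const, measureReal_restrict_apply hA]
      simp [mul_comm]
    rw [← h1, add_assoc, ← withDensityᵥ_add (hf.sub hg) hg]
    rw [sub_add_cancel]
    exact (ν.singularPart_add_withDensity_rnDeriv_eq volume).symm
  have hint : ∀ (m : Measure Plane) [IsFiniteMeasure m], Integrable φ m := fun m _ =>
    hφ.integrable_of_hasCompactSupport hc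
  have hv : ∀ τ : SignedMeasure Plane, τ.Integrable φ := fun τ => by
    have : IsFiniteMeasure τ.variation := by rw [← τ.totalVariation_eq_variation]; infer_instance
    exact hint _
  have hflip : (ContinuousLinearMap.lsmul ℝ ℝ : ℝ →L[ℝ] ℝ →L[ℝ] ℝ).flip =
      ContinuousLinearMap.lsmul ℝ ℝ := by
    ext; simp
  have h3 : (∫ᵛ x, φ x ∂•(volume.restrict B).toSignedMeasure) = ∫ x, φ x := by
    rw [← hflip, VectorMeasure.integral_toSignedMeasure]
    exact setIntegral_eq_integral_of_forall_compl_eq_zero hφB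
  have h4 : (∫ᵛ x, φ x ∂•ν) - c * ∫ x, φ x =
      (∫ᵛ x, φ x ∂•s) + ∫ᵛ x, φ x ∂•(volume.withDensityᵥ (f - g)) := by
    conv_lhs => rw [hdec]
    rw [VectorMeasure.integral_add_vectorMeasure (hv _) (hv _),
      VectorMeasure.integral_add_vectorMeasure (hv _) (hv _),
      VectorMeasure.integral_smul_vectorMeasure, h3]
    simp
  rw [h4, deviationMeasure, lintegral_add_measure]
  refine (enorm_add_le _ _).trans (add_le_add ?_ ?_)
  · refine VectorMeasure.enorm_integral_le_lintegral_enorm_transpose.trans ?_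
    rw [VectorMeasure.variation_transpose_lsmul, s.totalVariation_eq_variation]
  · refine VectorMeasure.enorm_integral_le_lintegral_enorm_transpose.trans ?_
    rw [VectorMeasure.variation_transpose_lsmul, Measure.variation_withDensityᵥ (hf.sub hg),
      lintegral_withDensity_eq_lintegral_mul₀ (hf.sub hg).1.enorm hφ.enorm.measurable.aemeasurable,
      lintegral_withDensity_eq_lintegral_mul₀ (measurable_enorm_rnDeriv_sub ν c).aemeasurable
        hφ.enorm.measurable.aemeasurable]
    refine lintegral_mono fun x => ?_
    -- On `B` the truncated density `g` equals `c`; off `B` the function `φ` vanishes.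
    by_cases hx : x ∈ B
    · simp [g, hx, f]
    · simp [hφB x hx]

/-- Almost every point is a Lebesgue point of the density, and the singular part has zero density
there; both are differentiation along the Besicovitch Vitali family. -/
theorem ae_tendsto_deviationMeasure_div (ν : SignedMeasure Plane) :
    ∀ᵐ x : Plane, Tendsto (fun r => deviationMeasure ν (ν.rnDeriv volume x) (closedBall x r) /
      volume (closedBall x r)) (𝓝[>] 0) (𝓝 0) := by
  have hs : (ν.singularPart volume).totalVariation ⟂ₘ volume := by
    rw [SignedMeasure.singularPart_totalVariation]
    exact (Measure.mutuallySingular_singularPart _ _).add_left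
      (Measure.mutuallySingular_singularPart _ _)
  filter_upwards [(Besicovitch.vitaliFamily volume).ae_eventually_measure_zero_of_singular hs,
    (Besicovitch.vitaliFamily volume).ae_tendsto_lintegral_enorm_sub_div
      (ν.integrable_rnDeriv volume).locallyIntegrable] with x h1 h2
  have h3 := (h1.add h2).comp (Besicovitch.tendsto_filterAt volume x)
  rw [add_zero] at h3
  refine h3.congr fun r => ?_
  simp only [Function.comp, deviationMeasure, Measure.add_apply]
  rw [withDensity_apply _ measurableSet_closedBall, ENNReal.add_div]

/-! ### The mollifier and mollified gradients -/

theorem integral_expNegInvGlue_pos : 0 < ∫ y : Plane, expNegInvGlue (1 - ‖y‖ ^ 2) := by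
  have hcont : Continuous fun y : Plane => expNegInvGlue (1 - ‖y‖ ^ 2) :=
    (expNegInvGlue.contDiff (n := 0)).continuous.comp (by fun_prop)
  refine hcont.integral_pos_of_hasCompactSupport_nonneg_nonzero ?_
    (fun _ => expNegInvGlue.nonneg _) (x := 0) ?_
  · refine HasCompactSupport.intro (isCompact_closedBall (0 : Plane) 1) fun x hx => ?_
    have : 1 < ‖x‖ := by simpa using hx
    exact expNegInvGlue.zero_of_nonpos (by nlinarith)
  · exact (expNegInvGlue.pos_of_pos (by simp)).ne'

theorem scaledMollifier_nonneg (ε : ℝ) (x : Plane) : 0 ≤ scaledMollifier ε x :=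
  mul_nonneg (by positivity)
    (div_nonneg (expNegInvGlue.nonneg _) integral_expNegInvGlue_pos.le)

theorem scaledMollifier_eq_zero {ε : ℝ} (hε : 0 < ε) {x : Plane} (hx : ε ≤ ‖x‖) :
    scaledMollifier ε x = 0 := by
  have : 1 ≤ ‖ε⁻¹ • x‖ := by
    rw [norm_smul, norm_inv, Real.norm_of_nonneg hε.le, inv_mul_eq_div, one_le_div hε]
    exact hx
  rw [scaledMollifier, standardMollifier, expNegInvGlue.zero_of_nonpos (by nlinarith)]
  simp

theorem contDiff_scaledMollifier (ε : ℝ) : ContDiff ℝ ∞ (scaledMollifier ε) := by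
  have h : ContDiff ℝ ∞ standardMollifier :=
    ((expNegInvGlue.contDiff (n := ⊤)).comp (contDiff_const.sub (contDiff_norm_sq ℝ))).div_const _
  exact contDiff_const.mul (h.comp (contDiff_const_smul _))

theorem hasCompactSupport_scaledMollifier {ε : ℝ} (hε : 0 < ε) :
    HasCompactSupport (scaledMollifier ε) :=
  HasCompactSupport.intro (isCompact_closedBall (0 : Plane) ε) fun x hx =>
    scaledMollifier_eq_zero hε (by simpa using (not_le.1 (by simpa using hx)).le)

theorem integral_scaledMollifier {ε : ℝ} (hε : 0 < ε) : ∫ x, scaledMollifier ε x = 1 := by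
  have h1 : ∫ x, standardMollifier x = 1 := by
    simp only [standardMollifier]
    rw [integral_div, div_self integral_expNegInvGlue_pos.ne']
  simp only [scaledMollifier]
  rw [integral_const_mul, Measure.integral_comp_inv_smul, h1]
  simp [abs_of_pos hε, hε.ne']

theorem integrable_scaledMollifier {ε : ℝ} (hε : 0 < ε) : Integrable (scaledMollifier ε) :=
  (contDiff_scaledMollifier ε).continuous.integrable_of_hasCompactSupport
    (hasCompactSupport_scaledMollifier hε)

theorem lintegral_enorm_scaledMollifier_sub {ε : ℝ} (hε : 0 < ε) (y : Plane) :
    ∫⁻ x, ‖scaledMollifier ε (x - y)‖ₑ = 1 := by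
  rw [lintegral_sub_right_eq_self (fun x => ‖scaledMollifier ε x‖ₑ) y,
    ← ofReal_integral_norm_eq_lintegral_enorm (integrable_scaledMollifier hε)]
  simp_rw [Real.norm_of_nonneg (scaledMollifier_nonneg ε _)]
  rw [integral_scaledMollifier hε, ENNReal.ofReal_one]

/-- The mollification of a scalar function. -/
def scalarMollification (ε : ℝ) (u : Plane → ℝ) : Plane → ℝ :=
  scaledMollifier ε ⋆[ContinuousLinearMap.lsmul ℝ ℝ, volume] u

theorem scalarMollification_apply (ε : ℝ) (u : Plane → ℝ) (x : Plane) :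
    scalarMollification ε u x = ∫ t, scaledMollifier ε t * u (x - t) := rfl

theorem integrable_scaledMollifier_mul {ε : ℝ} (hε : 0 < ε) {u : Plane → ℝ}
    (hu : LocallyIntegrable u volume) (x : Plane) :
    Integrable fun t => scaledMollifier ε t * u (x - t) :=
  (hasCompactSupport_scaledMollifier hε).convolutionExists_left
    (ContinuousLinearMap.lsmul ℝ ℝ) (contDiff_scaledMollifier ε).continuous hu x

theorem contDiff_scalarMollification {ε : ℝ} (hε : 0 < ε) {u : Plane → ℝ}
    (hu : LocallyIntegrable u volume) : ContDiff ℝ ∞ (scalarMollification ε u) :=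
  (hasCompactSupport_scaledMollifier hε).contDiff_convolution_left _
    (contDiff_scaledMollifier ε) hu

theorem fderiv_scalarMollification {ε : ℝ} (hε : 0 < ε) {u : Plane → ℝ}
    (hu : LocallyIntegrable u volume) (x v : Plane) :
    fderiv ℝ (scalarMollification ε u) x v =
      ∫ y, u y * fderiv ℝ (scaledMollifier ε) (x - y) v := by
  have h1 := (hasCompactSupport_scaledMollifier hε).hasFDerivAt_convolution_left
    (ContinuousLinearMap.lsmul ℝ ℝ) ((contDiff_scaledMollifier ε).of_le (by simp)) hu x
  have h2 : Continuous (fderiv ℝ (scaledMollifier ε)) :=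
    (contDiff_scaledMollifier ε).continuous_fderiv (by simp)
  have h3 := ((hasCompactSupport_scaledMollifier hε).fderiv ℝ).convolutionExists_left
    ((ContinuousLinearMap.lsmul ℝ ℝ : ℝ →L[ℝ] ℝ →L[ℝ] ℝ).precompL Plane) h2 hu x
  rw [scalarMollification, h1.fderiv, convolution_def,
    ContinuousLinearMap.integral_apply h3, ← integral_sub_left_eq_self _ volume x]
  refine integral_congr_ae (Eventually.of_forall fun y => ?_)
  simp [mul_comm]

theorem mollification_apply {U : Opens Plane} {h : Plane → Plane} {ε : ℝ} (hε : 0 < ε)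
    (hh : IntegrableOn h (U : Set Plane) volume) (x : Plane) (i : Fin 2) :
    mollification U h ε x i =
      scalarMollification ε ((U : Set Plane).indicator fun y => h y i) x := by
  have hl : LocallyIntegrable ((U : Set Plane).indicator h) volume :=
    ((integrable_indicator_iff U.isOpen.measurableSet).2 hh).locallyIntegrable
  have h1 := (hasCompactSupport_scaledMollifier hε).convolutionExists_left
    (ContinuousLinearMap.lsmul ℝ ℝ) (contDiff_scaledMollifier ε).continuous hl x
  rw [mollification, convolution_def, scalarMollification, convolution_def]
  have h2 := (EuclideanSpace.proj i : Plane →L[ℝ] ℝ).integral_comp_comm h1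
  refine Eq.trans h2.symm (integral_congr_ae (Eventually.of_forall fun t => ?_))
  by_cases ht : x - t ∈ (U : Set Plane) <;> simp [ht, indicator]

theorem contDiff_mollification {U : Opens Plane} {h : Plane → Plane} {ε : ℝ} (hε : 0 < ε)
    (hh : IntegrableOn h (U : Set Plane) volume) : ContDiff ℝ ∞ (mollification U h ε) :=
  (hasCompactSupport_scaledMollifier hε).contDiff_convolution_left _ (contDiff_scaledMollifier ε)
    ((integrable_indicator_iff U.isOpen.measurableSet).2 hh).locallyIntegrable

/-- The reflected and translated mollifier `y ↦ ρ_ε (x - y)` as a test function. -/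
def mollifierTest {U : Opens Plane} {ε : ℝ} (hε : 0 < ε) {x : Plane}
    (hx : closedBall x ε ⊆ (U : Set Plane)) : 𝓓(U, ℝ) where
  toFun y := scaledMollifier ε (x - y)
  contDiff' := (contDiff_scaledMollifier ε).comp (contDiff_const.sub contDiff_id)
  hasCompactSupport' := HasCompactSupport.intro (isCompact_closedBall x ε) fun y hy =>
    scaledMollifier_eq_zero hε (by
      rw [mem_closedBall', dist_eq_norm, not_le] at hy
      exact hy.le)
  tsupport_subset' := by
    refine (closure_minimal (fun y hy => ?_) isClosed_closedBall).trans hx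
    by_contra hy'
    rw [mem_closedBall', dist_eq_norm, not_le] at hy'
    exact hy (scaledMollifier_eq_zero hε hy'.le)

/-- The derivative of `u_ε` at `x` is minus the pairing of `u` with the derivative of the test
function `y ↦ ρ_ε (x - y)`, which has integral `1`; so `H` applied to it compares this derivative
with `c`. -/
theorem enorm_fderiv_scalarMollification_sub_le {U : Opens Plane} {u : Plane → ℝ} {j : Fin 2}
    {c : ℝ} {m : Measure Plane} (hu : IntegrableOn u (U : Set Plane) volume)
    (H : ∀ φ : 𝓓(U, ℝ), ‖(∫ x in (U : Set Plane), u x *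
      fderiv ℝ φ x (EuclideanSpace.single j 1)) + c * ∫ x, φ x‖ₑ ≤ ∫⁻ x, ‖φ x‖ₑ ∂m)
    {ε : ℝ} (hε : 0 < ε) {x : Plane} (hx : closedBall x ε ⊆ (U : Set Plane)) :
    ‖fderiv ℝ (scalarMollification ε ((U : Set Plane).indicator u)) x
      (EuclideanSpace.single j 1) - c‖ₑ ≤ ∫⁻ y, ‖scaledMollifier ε (x - y)‖ₑ ∂m := by
  have hl : LocallyIntegrable ((U : Set Plane).indicator u) volume :=
    ((integrable_indicator_iff U.isOpen.measurableSet).2 hu).locallyIntegrable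
  have hφ : ∀ y, mollifierTest hε hx y = scaledMollifier ε (x - y) := fun _ => rfl
  have h1 := H (mollifierTest hε hx)
  have hfd : ∀ y v, fderiv ℝ (mollifierTest hε hx) y v =
      - fderiv ℝ (scaledMollifier ε) (x - y) v := fun y v => by
    have h := (((contDiff_scaledMollifier ε).differentiable (by simp)) (x - y)).hasFDerivAt.comp y
      ((hasFDerivAt_id y).const_sub x)
    have h' : HasFDerivAt (mollifierTest hε hx) _ y := h
    rw [h'.fderiv]
    simp
  simp_rw [hfd, hφ] at h1
  rw [integral_sub_left_eq_self (scaledMollifier ε) volume x, integral_scaledMollifier hε] at h1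
  rw [fderiv_scalarMollification hε hl, ← enorm_neg]
  refine le_of_eq_of_le (congrArg _ ?_) h1
  rw [neg_sub, sub_eq_neg_add, mul_one, ← integral_indicator U.isOpen.measurableSet,
    ← integral_neg]
  congr 2
  ext y
  by_cases hy : y ∈ (U : Set Plane) <;> simp [hy, indicator]

/-- By Tonelli: each `y` spreads unit mass over `x`, and only `y ∈ V` can reach a point of `A`. The
bound does not depend on `ε`. -/
theorem setLIntegral_enorm_fderiv_scalarMollification_sub_le {U : Opens Plane} {u : Plane → ℝ}
    {j : Fin 2} {c : ℝ} {m : Measure Plane} [SFinite m]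
    (hu : IntegrableOn u (U : Set Plane) volume)
    (H : ∀ φ : 𝓓(U, ℝ), ‖(∫ x in (U : Set Plane), u x *
      fderiv ℝ φ x (EuclideanSpace.single j 1)) + c * ∫ x, φ x‖ₑ ≤ ∫⁻ x, ‖φ x‖ₑ ∂m)
    {ε : ℝ} (hε : 0 < ε) {A V : Set Plane} (hA : MeasurableSet A) (hV : MeasurableSet V)
    (hAV : ∀ x ∈ A, closedBall x ε ⊆ V) (hVU : V ⊆ U) :
    ∫⁻ x in A, ‖fderiv ℝ (scalarMollification ε ((U : Set Plane).indicator u)) x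
      (EuclideanSpace.single j 1) - c‖ₑ ≤ m V := by
  have hmeas : Measurable fun p : Plane × Plane => ‖scaledMollifier ε (p.1 - p.2)‖ₑ :=
    ((contDiff_scaledMollifier ε).continuous.comp
      (continuous_fst.sub continuous_snd)).enorm.measurable
  calc
    _ ≤ ∫⁻ x in A, ∫⁻ y in V, ‖scaledMollifier ε (x - y)‖ₑ ∂m := by
      refine setLIntegral_mono' hA fun x hx => ?_
      refine (enorm_fderiv_scalarMollification_sub_le hu H hε ((hAV x hx).trans hVU)).trans ?_
      rw [← lintegral_indicator hV]
      refine lintegral_mono fun y => ?_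
      by_cases hy : y ∈ V
      · simp [hy]
      · have : ε < ‖x - y‖ := by
          rw [← dist_eq_norm, dist_comm, ← not_le]
          exact fun h => hy (hAV x hx h)
        simp [scaledMollifier_eq_zero hε this.le]
    _ ≤ ∫⁻ x, ∫⁻ y in V, ‖scaledMollifier ε (x - y)‖ₑ ∂m := setLIntegral_le_lintegral _ _
    _ = ∫⁻ y in V, (∫⁻ x, ‖scaledMollifier ε (x - y)‖ₑ) ∂m :=
      lintegral_lintegral_swap (f := fun x y => ‖scaledMollifier ε (x - y)‖ₑ)
        (by exact hmeas.aemeasurable)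
    _ = m V := by simp [lintegral_enorm_scaledMollifier_sub hε]

/-- Mollification averages translates with a probability density, so it preserves oscillation
bounds. -/
theorem abs_scalarMollification_sub_le {ε : ℝ} (hε : 0 < ε) {u : Plane → ℝ}
    (hu : LocallyIntegrable u volume) {p q : Plane} {κ : ℝ}
    (hκ : ∀ z : Plane, ‖z‖ ≤ ε → |u (p - z) - u (q - z)| ≤ κ) :
    |scalarMollification ε u p - scalarMollification ε u q| ≤ κ := by
  rw [scalarMollification_apply, scalarMollification_apply,
    ← integral_sub (integrable_scaledMollifier_mul hε hu p)
      (integrable_scaledMollifier_mul hε hu q)]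
  calc
    |∫ t, (scaledMollifier ε t * u (p - t) - scaledMollifier ε t * u (q - t))|
    _ ≤ ∫ t, scaledMollifier ε t * κ := by
      rw [← Real.norm_eq_abs]
      refine norm_integral_le_of_norm_le ((integrable_scaledMollifier hε).mul_const κ)
        (Eventually.of_forall fun t => ?_)
      rcases le_total ε ‖t‖ with ht | ht
      · simp [scaledMollifier_eq_zero hε ht]
      · rw [← mul_sub, norm_mul, Real.norm_of_nonneg (scaledMollifier_nonneg ε t)]
        exact mul_le_mul_of_nonneg_left (hκ t ht) (scaledMollifier_nonneg ε t)
    _ = κ := by rw [integral_mul_const, integral_scaledMollifier hε, one_mul]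

/-! ### Oscillation on rectangles and square frames -/

/-- If `∫∫ |∂_y F|` over a rectangle is at most `K` times its width, and `F` oscillates by at most
`κ` along horizontal segments, then `F` oscillates by at most `2 κ + K` on the rectangle. -/
theorem abs_sub_le_of_setLIntegral_deriv_le {F G : ℝ → ℝ → ℝ}
    (hF : ∀ x y, HasDerivAt (F x) (G x y) y) (hG : Continuous (Function.uncurry G))
    {a b c d K κ : ℝ} (hab : a < b) (hK0 : 0 ≤ K)
    (hK : ∫⁻ p in Icc a b ×ˢ Icc c d, ‖G p.1 p.2‖ₑ ≤ ENNReal.ofReal (K * (b - a)))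
    (hκ : ∀ x ∈ Icc a b, ∀ x' ∈ Icc a b, ∀ y ∈ Icc c d, |F x y - F x' y| ≤ κ)
    {x x' y y' : ℝ} (hx : x ∈ Icc a b) (hx' : x' ∈ Icc a b) (hy : y ∈ Icc c d)
    (hy' : y' ∈ Icc c d) : |F x y - F x' y'| ≤ 2 * κ + K := by
  have hGm : Measurable fun p : ℝ × ℝ => ‖G p.1 p.2‖ₑ := hG.enorm.measurable
  have hvol : volume (Icc a b) ≠ 0 := by simpa using hab
  -- Some vertical line carries at most the average, namely `K`.
  obtain ⟨t, ht, hle⟩ := exists_le_setLAverage (μ := volume) (s := Icc a b)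
    (f := fun x => ∫⁻ y in Icc c d, ‖G x y‖ₑ) hvol (by simp)
    (Measurable.lintegral_prod_right' (f := fun p : ℝ × ℝ => ‖G p.1 p.2‖ₑ) hGm).aemeasurable
  have hle' : ∫⁻ y in Icc c d, ‖G t y‖ₑ ≤ ENNReal.ofReal K := by
    refine hle.trans ?_
    rw [setLAverage_eq, Real.volume_Icc]
    rw [Measure.volume_eq_prod, ← Measure.prod_restrict, lintegral_prod _ hGm.aemeasurable] at hK
    refine ENNReal.div_le_of_le_mul (hK.trans_eq ?_)
    rw [ENNReal.ofReal_mul hK0]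
  have hGt : Continuous (G t) := hG.comp (Continuous.prodMk_right t)
  have hvar : |F t y - F t y'| ≤ K := by
    rw [← intervalIntegral.integral_eq_sub_of_hasDerivAt (fun z _ => hF t z)
      (hGt.intervalIntegrable _ _), ← ENNReal.ofReal_le_ofReal_iff hK0, ← Real.norm_eq_abs,
      ofReal_norm]
    refine (le_of_eq_of_le ?_ (enorm_integral_le_lintegral_enorm
      (μ := volume.restrict (uIoc y' y)) (G t))).trans (le_trans ?_ hle')
    · rw [← ofReal_norm, ← ofReal_norm, intervalIntegral.norm_integral_eq_norm_integral_uIoc]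
    · refine lintegral_mono_set fun z hz => ?_
      exact uIcc_subset_Icc hy' hy (uIoc_subset_uIcc hz)
  -- Path `(x, y) → (t, y) → (t, y') → (x', y')`: two short horizontal moves and one along the good
  -- line.
  have h1 := hκ x hx t ht y hy
  have h2 := hκ t ht x' hx' y' hy'
  rw [abs_le] at *
  constructor <;> linarith

/-- The closed square with centre `x₀` and half side `b`. -/
def square (x₀ : Plane) (b : ℝ) : Set Plane := {p | ∀ i, |p i - x₀ i| ≤ b}

/-- The closed square frame with centre `x₀` and half sides `a < b`. -/
def squareFrame (x₀ : Plane) (a b : ℝ) : Set Plane :=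
  {p | p ∈ square x₀ b ∧ ∃ i, a ≤ |p i - x₀ i|}

theorem isClosed_square (x₀ : Plane) (b : ℝ) : IsClosed (square x₀ b) := by
  simp only [square, ofPred_forall]
  exact isClosed_iInter fun i => isClosed_le (by fun_prop) continuous_const

theorem isClosed_squareFrame (x₀ : Plane) (a b : ℝ) : IsClosed (squareFrame x₀ a b) := by
  have h : squareFrame x₀ a b = square x₀ b ∩ ⋃ i, {p : Plane | a ≤ |p i - x₀ i|} := by
    ext p; simp [squareFrame, and_or_left]
  rw [h]
  exact (isClosed_square x₀ b).inter
    (isClosed_iUnion_of_finite fun i => isClosed_le continuous_const (by fun_prop))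

/-- The parametrization `(x, y) ↦ x₀ + (x, y)` of the plane by `ℝ × ℝ`. -/
def planeChart (x₀ : Plane) (p : ℝ × ℝ) : Plane := x₀ + WithLp.toLp 2 ![p.1, p.2]

theorem measurePreserving_planeChart (x₀ : Plane) : MeasurePreserving (planeChart x₀) :=
  (measurePreserving_add_left volume x₀).comp ((PiLp.volume_preserving_toLp (Fin 2)).comp
    (volume_preserving_finTwoArrow ℝ).symm)

theorem planeChart_sub_zero (x₀ : Plane) (p : ℝ × ℝ) : planeChart x₀ p 0 - x₀ 0 = p.1 := by
  simp [planeChart]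

theorem planeChart_sub_one (x₀ : Plane) (p : ℝ × ℝ) : planeChart x₀ p 1 - x₀ 1 = p.2 := by
  simp [planeChart]

theorem planeChart_mem_square {x₀ : Plane} {p : ℝ × ℝ} {b : ℝ} :
    planeChart x₀ p ∈ square x₀ b ↔ |p.1| ≤ b ∧ |p.2| ≤ b := by
  simp [square, Fin.forall_fin_two, planeChart_sub_zero, planeChart_sub_one]

theorem planeChart_mem_squareFrame {x₀ : Plane} {p : ℝ × ℝ} {a b : ℝ} :
    planeChart x₀ p ∈ squareFrame x₀ a b ↔
      (|p.1| ≤ b ∧ |p.2| ≤ b) ∧ (a ≤ |p.1| ∨ a ≤ |p.2|) := by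
  simp only [squareFrame, mem_ofPred_eq, planeChart_mem_square, Fin.exists_fin_two,
    planeChart_sub_zero, planeChart_sub_one]

theorem planeChart_surjective (x₀ : Plane) : Function.Surjective (planeChart x₀) := fun q =>
  ⟨(q 0 - x₀ 0, q 1 - x₀ 1), by ext i; fin_cases i <;> simp [planeChart]⟩

theorem continuous_planeChart (x₀ : Plane) : Continuous (planeChart x₀) := by
  unfold planeChart; fun_prop

theorem hasDerivAt_planeChart_fst (x₀ : Plane) (x y : ℝ) :
    HasDerivAt (fun x => planeChart x₀ (x, y)) (EuclideanSpace.single 0 1) x := by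
  have h : (fun x => planeChart x₀ (x, y)) =
      fun x : ℝ => planeChart x₀ (0, y) + x • EuclideanSpace.single 0 1 := by
    ext x i; fin_cases i <;> simp [planeChart]
  rw [h]
  simpa using ((hasDerivAt_id x).smul_const (EuclideanSpace.single (0 : Fin 2) (1 : ℝ))).const_add
    (planeChart x₀ (0, y))

theorem hasDerivAt_planeChart_snd (x₀ : Plane) (x y : ℝ) :
    HasDerivAt (fun y => planeChart x₀ (x, y)) (EuclideanSpace.single 1 1) y := by
  have h : (fun y => planeChart x₀ (x, y)) =
      fun y : ℝ => planeChart x₀ (x, 0) + y • EuclideanSpace.single 1 1 := by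
    ext x i; fin_cases i <;> simp [planeChart]
  rw [h]
  simpa using ((hasDerivAt_id y).smul_const (EuclideanSpace.single (1 : Fin 2) (1 : ℝ))).const_add
    (planeChart x₀ (x, 0))

/-- A `C¹` function whose partial derivatives have small integrals over a square frame has small
oscillation on that frame. -/
theorem exists_abs_sub_le_of_mem_squareFrame {w : Plane → ℝ} (hw : ContDiff ℝ 1 w) {x₀ : Plane}
    {a b K κ : ℝ} (ha : 0 < a) (hab : a < b) (hK0 : 0 ≤ K)
    (hK : ∀ j : Fin 2, ∫⁻ p in squareFrame x₀ a b, ‖fderiv ℝ w p (EuclideanSpace.single j 1)‖ₑ ≤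
      ENNReal.ofReal (K * (b - a)))
    (hκ : ∀ p ∈ square x₀ b, ∀ q ∈ square x₀ b, (∀ i, |p i - q i| ≤ b - a) → |w p - w q| ≤ κ) :
    ∃ c, ∀ p ∈ squareFrame x₀ a b, |w p - c| ≤ 4 * κ + 2 * K := by
  have hfd : Continuous (fderiv ℝ w) := hw.continuous_fderiv (by simp)
  have hd := hw.differentiable (by simp)
  have hG : ∀ j : Fin 2, Continuous fun p : ℝ × ℝ =>
      fderiv ℝ w (planeChart x₀ p) (EuclideanSpace.single j 1) := fun j =>
    (hfd.comp (continuous_planeChart x₀)).clm_apply continuous_const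
  have hx : ∀ x y, HasDerivAt (fun x => w (planeChart x₀ (x, y)))
      (fderiv ℝ w (planeChart x₀ (x, y)) (EuclideanSpace.single 0 1)) x := fun x y =>
    (hd _).hasFDerivAt.comp_hasDerivAt x (hasDerivAt_planeChart_fst x₀ x y)
  have hy : ∀ x y, HasDerivAt (fun y => w (planeChart x₀ (x, y)))
      (fderiv ℝ w (planeChart x₀ (x, y)) (EuclideanSpace.single 1 1)) y := fun x y =>
    (hd _).hasFDerivAt.comp_hasDerivAt y (hasDerivAt_planeChart_snd x₀ x y)
  have hint : ∀ (j : Fin 2) (S : Set (ℝ × ℝ)),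
      (∀ p ∈ S, (|p.1| ≤ b ∧ |p.2| ≤ b) ∧ (a ≤ |p.1| ∨ a ≤ |p.2|)) →
      ∫⁻ p in S, ‖fderiv ℝ w (planeChart x₀ p) (EuclideanSpace.single j 1)‖ₑ ≤
        ENNReal.ofReal (K * (b - a)) := fun j S hS => by
    refine le_trans ?_ (hK j)
    rw [← (measurePreserving_planeChart x₀).setLIntegral_comp_preimage
      (isClosed_squareFrame x₀ a b).measurableSet
      (hfd.clm_apply continuous_const).enorm.measurable]
    exact lintegral_mono_set fun p hp => planeChart_mem_squareFrame.2 (hS p hp)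
  have hosc : ∀ x y x' y', |x| ≤ b → |y| ≤ b → |x'| ≤ b → |y'| ≤ b → |x - x'| ≤ b - a →
      |y - y'| ≤ b - a → |w (planeChart x₀ (x, y)) - w (planeChart x₀ (x', y'))| ≤ κ := by
    intro x y x' y' h1 h2 h3 h4 h5 h6
    refine hκ _ (planeChart_mem_square.2 ⟨h1, h2⟩) _ (planeChart_mem_square.2 ⟨h3, h4⟩) ?_
    rw [Fin.forall_fin_two]
    simp only [planeChart, PiLp.add_apply, Matrix.cons_val_zero, Matrix.cons_val_one,
      add_sub_add_left_eq_sub]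
    exact ⟨h5, h6⟩
  -- The frame is the union of two vertical and two horizontal strips of length `2 b` and width `b -
  -- a`; each is handled by the rectangle estimate.
  have hvert : ∀ l r, r - l = b - a → (∀ x ∈ Icc l r, a ≤ |x| ∧ |x| ≤ b) →
      ∀ x ∈ Icc l r, ∀ x' ∈ Icc l r, ∀ y ∈ Icc (-b) b, ∀ y' ∈ Icc (-b) b,
      |w (planeChart x₀ (x, y)) - w (planeChart x₀ (x', y'))| ≤ 2 * κ + K := by
    intro l r hlr hI x hx x' hx' y hy₁ y' hy'
    refine abs_sub_le_of_setLIntegral_deriv_le (F := fun x y => w (planeChart x₀ (x, y))) hy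
      (hG 1) (by linarith) hK0 ?_ ?_ hx hx' hy₁ hy'
    · rw [hlr]
      exact hint 1 _ fun p hp => ⟨⟨(hI _ hp.1).2, abs_le.2 hp.2⟩, Or.inl (hI _ hp.1).1⟩
    · intro x hx x' hx' y hy
      refine hosc _ _ _ _ (hI _ hx).2 (abs_le.2 hy) (hI _ hx').2 (abs_le.2 hy) ?_ ?_
      · rw [abs_le]; constructor <;> linarith [hx.1, hx.2, hx'.1, hx'.2]
      · simpa using hab.le
  have hhor : ∀ l r, r - l = b - a → (∀ x ∈ Icc l r, a ≤ |x| ∧ |x| ≤ b) →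
      ∀ x ∈ Icc (-b) b, ∀ x' ∈ Icc (-b) b, ∀ y ∈ Icc l r, ∀ y' ∈ Icc l r,
      |w (planeChart x₀ (x, y)) - w (planeChart x₀ (x', y'))| ≤ 2 * κ + K := by
    intro l r hlr hI x hx₁ x' hx' y hy y' hy'
    refine abs_sub_le_of_setLIntegral_deriv_le (F := fun y x => w (planeChart x₀ (x, y)))
      (fun y x => hx x y) ((hG 0).comp continuous_swap) (by linarith) hK0 ?_ ?_ hy hy' hx₁ hx'
    · rw [hlr]
      refine le_trans (le_of_eq ?_) (hint 0 (Icc (-b) b ×ˢ Icc l r)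
        fun p hp => ⟨⟨abs_le.2 hp.1, (hI _ hp.2).2⟩, Or.inr (hI _ hp.2).1⟩)
      have hswap : MeasurePreserving (Prod.swap : ℝ × ℝ → ℝ × ℝ) := Measure.measurePreserving_swap
      rw [← hswap.setLIntegral_comp_preimage
        (measurableSet_Icc.prod measurableSet_Icc) (hG 0).enorm.measurable, preimage_swap_prod]
      rfl
    · intro x hx x' hx' y hy
      refine hosc _ _ _ _ (abs_le.2 hy) (hI _ hx).2 (abs_le.2 hy) (hI _ hx').2 ?_ ?_
      · simpa using hab.le
      · rw [abs_le]; constructor <;> linarith [hx.1, hx.2, hx'.1, hx'.2]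
  have hIpos : ∀ x ∈ Icc a b, a ≤ |x| ∧ |x| ≤ b := fun x hx => by
    rwa [abs_of_nonneg (ha.le.trans hx.1)]
  have hIneg : ∀ x ∈ Icc (-b) (-a), a ≤ |x| ∧ |x| ≤ b := fun x hx => by
    rw [abs_of_nonpos (by linarith [hx.2])]
    exact ⟨by linarith [hx.2], by linarith [hx.1]⟩
  have hb0 : 0 < b := ha.trans hab
  have mb : b ∈ Icc a b := ⟨hab.le, le_rfl⟩
  have mb' : b ∈ Icc (-b) b := ⟨by linarith, le_rfl⟩
  have mn : -b ∈ Icc (-b) (-a) := ⟨le_rfl, by linarith⟩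
  have mn' : -b ∈ Icc (-b) b := ⟨le_rfl, by linarith⟩
  have hκ0 : 0 ≤ κ := (abs_nonneg _).trans
    (hosc b b b b (abs_of_pos hb0).le (abs_of_pos hb0).le (abs_of_pos hb0).le
      (abs_of_pos hb0).le (by simpa using hab.le) (by simpa using hab.le))
  -- The reference value is taken at the corner `(b, b)`, which lies in the right and top strips.
  -- The left and bottom strips reach it through one more corner, so at most two strips are crossed.
  refine ⟨w (planeChart x₀ (b, b)), fun p hp => ?_⟩
  obtain ⟨⟨x, y⟩, rfl⟩ := planeChart_surjective x₀ p
  obtain ⟨⟨hx1, hy1⟩, h⟩ := planeChart_mem_squareFrame.1 hp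
  simp only at hx1 hy1 h
  have hxI := abs_le.1 hx1
  have hyI := abs_le.1 hy1
  rcases h with h | h <;> rcases le_abs.1 h with h | h
  · have := hvert a b rfl hIpos x ⟨h, hxI.2⟩ b mb y hyI b mb'
    linarith
  · have h1 := hvert (-b) (-a) (by ring) hIneg x ⟨hxI.1, by linarith⟩ (-b) mn y hyI b mb'
    have h2 := hhor a b rfl hIpos (-b) mn' b mb' b mb b mb
    have h3 := abs_sub_le (w (planeChart x₀ (x, y))) (w (planeChart x₀ (-b, b)))
      (w (planeChart x₀ (b, b)))
    linarith
  · have := hhor a b rfl hIpos x hxI b mb' y ⟨h, hyI.2⟩ b mb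
    linarith
  · have h1 := hhor (-b) (-a) (by ring) hIneg x hxI b mb' y ⟨hyI.1, by linarith⟩ (-b) mn
    have h2 := hvert a b rfl hIpos b mb b mb (-b) mn' b mb'
    have h3 := abs_sub_le (w (planeChart x₀ (x, y))) (w (planeChart x₀ (b, -b)))
      (w (planeChart x₀ (b, b)))
    linarith

/-! ### Cut-off functions between squares -/

theorem exists_abs_deriv_smoothTransition_le :
    ∃ C : ℝ, 0 < C ∧ ∀ x, |deriv Real.smoothTransition x| ≤ C := by
  have hc : Continuous (deriv Real.smoothTransition) :=
    (Real.smoothTransition.contDiff (n := 1)).continuous_deriv (by simp)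
  obtain ⟨C, hC⟩ := isCompact_Icc.exists_bound_of_continuousOn (s := Icc (0 : ℝ) 1) hc.continuousOn
  refine ⟨max C 1, by positivity, fun x => ?_⟩
  by_cases hx : x ∈ Icc (0 : ℝ) 1
  · exact (hC x hx).trans (le_max_left _ _)
  · have h0 : deriv Real.smoothTransition x = 0 := by
      rw [mem_Icc, not_and_or, not_le, not_le] at hx
      rcases hx with hx | hx
      · have : Real.smoothTransition =ᶠ[𝓝 x] fun _ => 0 := by
          filter_upwards [Iio_mem_nhds hx] with y hy using Real.smoothTransition.zero_of_nonpos hy.le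
        rw [this.deriv_eq, deriv_const]
      · have : Real.smoothTransition =ᶠ[𝓝 x] fun _ => 1 := by
          filter_upwards [Ioi_mem_nhds hx] with y hy using Real.smoothTransition.one_of_one_le hy.le
        rw [this.deriv_eq, deriv_const]
    rw [h0, abs_zero]
    positivity

theorem exists_cutoff_interval : ∃ C : ℝ, 0 < C ∧ ∀ a b : ℝ, 0 < a → a < b → ∃ χ : ℝ → ℝ,
    ContDiff ℝ ∞ χ ∧ (∀ t, 0 ≤ χ t) ∧ (∀ t, χ t ≤ 1) ∧ (∀ t, |t| ≤ a → χ t = 1) ∧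
    (∀ t, b ≤ |t| → χ t = 0) ∧ ∀ t, |deriv χ t| ≤ C / (b - a) := by
  obtain ⟨C, hC0, hC⟩ := exists_abs_deriv_smoothTransition_le
  refine ⟨2 * C, by positivity, fun a b ha hab => ?_⟩
  have hs : 0 < b - a := sub_pos.2 hab
  set T := Real.smoothTransition
  have hT : ContDiff ℝ ∞ T := Real.smoothTransition.contDiff (n := ⊤)
  have hT0 : ∀ t, 0 ≤ T t := Real.smoothTransition.nonneg
  have hT1 : ∀ t, T t ≤ 1 := Real.smoothTransition.le_one
  -- One factor descends on `[a, b]`, the other on `[-b, -a]`; rescaling the fixed profile `T` makes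
  -- the constant independent of `a` and `b`.
  refine ⟨fun t => T ((b - t) / (b - a)) * T ((b + t) / (b - a)), ?_, fun t => ?_, fun t => ?_,
    fun t ht => ?_, fun t ht => ?_, fun t => ?_⟩
  · exact (hT.comp ((contDiff_const.sub contDiff_id).div_const _)).mul
      (hT.comp ((contDiff_const.add contDiff_id).div_const _))
  · exact mul_nonneg (hT0 _) (hT0 _)
  · exact mul_le_one₀ (hT1 _) (hT0 _) (hT1 _)
  · rw [abs_le] at ht
    simp only [T]
    rw [Real.smoothTransition.one_of_one_le, Real.smoothTransition.one_of_one_le, mul_one]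
    · rw [one_le_div hs]; linarith
    · rw [one_le_div hs]; linarith
  · simp only [T]
    rcases le_abs.1 ht with h | h
    · rw [Real.smoothTransition.zero_of_nonpos, zero_mul]
      exact div_nonpos_of_nonpos_of_nonneg (by linarith) hs.le
    · rw [mul_comm, Real.smoothTransition.zero_of_nonpos, zero_mul]
      exact div_nonpos_of_nonpos_of_nonneg (by linarith) hs.le
  · have hTd : ∀ x, HasDerivAt T (deriv T x) x := fun x =>
      ((hT.differentiable (by simp)) x).hasDerivAt
    have h1 : HasDerivAt (fun t => T ((b - t) / (b - a))) (deriv T ((b - t) / (b - a)) *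
        (-1 / (b - a))) t :=
      (hTd _).comp t (((hasDerivAt_id t).const_sub b).div_const _)
    have h2 : HasDerivAt (fun t => T ((b + t) / (b - a))) (deriv T ((b + t) / (b - a)) *
        (1 / (b - a))) t :=
      (hTd _).comp t (((hasDerivAt_id t).const_add b).div_const _)
    rw [(h1.fun_mul h2).deriv]
    have key : ∀ x y : ℝ, |deriv T x * T y| ≤ C := fun x y => by
      rw [abs_mul, abs_of_nonneg (hT0 y)]
      exact (mul_le_mul (hC x) (hT1 y) (hT0 y) hC0.le).trans_eq (mul_one C)
    calc
      _ = |(deriv T ((b + t) / (b - a)) * T ((b - t) / (b - a))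
          - deriv T ((b - t) / (b - a)) * T ((b + t) / (b - a))) / (b - a)| := by
        congr 1; ring
      _ ≤ _ := by
        rw [abs_div, abs_of_pos hs]
        refine div_le_div_of_nonneg_right ?_ hs.le
        have k1 := key ((b + t) / (b - a)) ((b - t) / (b - a))
        have k2 := key ((b - t) / (b - a)) ((b + t) / (b - a))
        exact (abs_sub _ _).trans (by linarith)

theorem isCompact_square (x₀ : Plane) (b : ℝ) : IsCompact (square x₀ b) := by
  refine Metric.isCompact_of_isClosed_isBounded (isClosed_square x₀ b)
    ((isBounded_closedBall (x := x₀) (r := 2 * |b|)).subset fun p hp => ?_)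
  rw [mem_closedBall, dist_eq_norm, EuclideanSpace.norm_eq, Fin.sum_univ_two]
  have h : ∀ i, ‖(p - x₀) i‖ ^ 2 ≤ |b| ^ 2 := fun i =>
    pow_le_pow_left₀ (norm_nonneg _) ((hp i).trans (le_abs_self b)) 2
  refine Real.sqrt_le_iff.2 ⟨by positivity, ?_⟩
  nlinarith [h 0, h 1, sq_nonneg b, abs_nonneg b]

/-- Smooth cut-off functions between concentric squares, with the natural gradient bound. -/
theorem exists_cutoff_square : ∃ C : ℝ, 0 < C ∧ ∀ (x₀ : Plane) (a b : ℝ), 0 < a → a < b →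
    ∃ φ : Plane → ℝ, ContDiff ℝ ∞ φ ∧ (∀ p, 0 ≤ φ p) ∧ (∀ p, φ p ≤ 1) ∧
    (∀ p ∈ square x₀ a, φ p = 1) ∧ (∀ p ∉ square x₀ b, φ p = 0) ∧
    (∀ p (j : Fin 2), |fderiv ℝ φ p (EuclideanSpace.single j 1)| ≤ C / (b - a)) ∧
    ∀ p ∉ squareFrame x₀ a b, fderiv ℝ φ p = 0 := by
  obtain ⟨C, hC0, hC⟩ := exists_cutoff_interval
  refine ⟨C, hC0, fun x₀ a b ha hab => ?_⟩
  obtain ⟨χ, hχ, h0, h1, hin, hout, hder⟩ := hC a b ha hab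
  have hφ1 : ∀ p ∈ square x₀ a, χ (p 0 - x₀ 0) * χ (p 1 - x₀ 1) = 1 := fun p hp => by
    rw [hin _ (hp 0), hin _ (hp 1), mul_one]
  have hφ0 : ∀ p ∉ square x₀ b, χ (p 0 - x₀ 0) * χ (p 1 - x₀ 1) = 0 := fun p hp => by
    simp only [square, mem_ofPred_eq, Fin.forall_fin_two, not_and_or, not_le] at hp
    rcases hp with hp | hp
    · rw [hout _ hp.le, zero_mul]
    · rw [hout _ hp.le, mul_zero]
  have hlin : ∀ (i : Fin 2) (p : Plane), HasFDerivAt (fun p : Plane => χ (p i - x₀ i))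
      (deriv χ (p i - x₀ i) • (EuclideanSpace.proj i : Plane →L[ℝ] ℝ)) p := fun i p => by
    have hχd : HasDerivAt χ (deriv χ (p i - x₀ i)) (p i - x₀ i) :=
      ((hχ.differentiable (by simp)) _).hasDerivAt
    exact hχd.comp_hasFDerivAt p
      ((EuclideanSpace.proj i : Plane →L[ℝ] ℝ).hasFDerivAt.sub_const (x₀ i))
  refine ⟨fun p => χ (p 0 - x₀ 0) * χ (p 1 - x₀ 1), ?_, fun p => mul_nonneg (h0 _) (h0 _),
    fun p => mul_le_one₀ (h1 _) (h0 _) (h1 _), hφ1, hφ0, fun p j => ?_, fun p hp => ?_⟩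
  · exact (hχ.comp ((EuclideanSpace.proj (0 : Fin 2) : Plane →L[ℝ] ℝ).contDiff.sub
      contDiff_const)).mul (hχ.comp ((EuclideanSpace.proj (1 : Fin 2) :
      Plane →L[ℝ] ℝ).contDiff.sub contDiff_const))
  · have key : ∀ s t, |χ s * deriv χ t| ≤ C / (b - a) := fun s t => by
      rw [abs_mul, abs_of_nonneg (h0 s)]
      exact (mul_le_of_le_one_left (abs_nonneg _) (h1 s)).trans (hder t)
    rw [((hlin 0 p).fun_mul (hlin 1 p)).fderiv]
    fin_cases j
    · simpa using key (p 1 - x₀ 1) (p 0 - x₀ 0)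
    · simpa using key (p 0 - x₀ 0) (p 1 - x₀ 1)
  -- Off the frame, `p` lies in the open inner square or outside the closed outer one, and `φ` is
  -- locally constant in both regions.
  · by_cases hb : p ∈ square x₀ b
    · have hlt : ∀ i, |p i - x₀ i| < a := fun i => not_le.1 fun h => hp ⟨hb, i, h⟩
      have hev : (fun p : Plane => χ (p 0 - x₀ 0) * χ (p 1 - x₀ 1)) =ᶠ[𝓝 p] fun _ => 1 := by
        have : ∀ᶠ q : Plane in 𝓝 p, ∀ i, |q i - x₀ i| < a := eventually_all.2 fun i =>
          (Continuous.tendsto (f := fun q : Plane => |q i - x₀ i|) (by fun_prop) p).eventually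
            (gt_mem_nhds (hlt i))
        filter_upwards [this] with q hq using hφ1 q fun i => (hq i).le
      rw [hev.fderiv_eq, fderiv_const_apply]
    · have hev : (fun p : Plane => χ (p 0 - x₀ 0) * χ (p 1 - x₀ 1)) =ᶠ[𝓝 p] fun _ => 0 := by
        filter_upwards [(isClosed_square x₀ b).isOpen_compl.mem_nhds hb] with q hq using hφ0 q hq
      rw [hev.fderiv_eq, fderiv_const_apply]

/-! ### The Jacobian as a null Lagrangian -/

/-- The Jacobian determinant is a null Lagrangian: integration by parts moves one derivative to
the test function, up to an arbitrary additive constant. -/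
theorem integral_mul_jacobian_eq {φ u v : Plane → ℝ} (hφ : ContDiff ℝ 1 φ)
    (hc : HasCompactSupport φ) (hu : ContDiff ℝ 1 u) (hv : ContDiff ℝ 2 v) (c : ℝ) (e f : Plane) :
    ∫ x, φ x * (fderiv ℝ u x e * fderiv ℝ v x f - fderiv ℝ u x f * fderiv ℝ v x e) =
      (∫ x, (u x - c) * fderiv ℝ φ x f * fderiv ℝ v x e) -
        ∫ x, (u x - c) * fderiv ℝ φ x e * fderiv ℝ v x f := by
  have hdv : ∀ e : Plane, ContDiff ℝ 1 fun x => fderiv ℝ v x e := fun e =>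
    (hv.fderiv_right (m := 1) (by norm_num)).clm_apply contDiff_const
  have hdφ : ∀ e : Plane, Continuous fun x => fderiv ℝ φ x e := fun e =>
    (hφ.continuous_fderiv (by simp)).clm_apply continuous_const
  have hdu : ∀ e : Plane, Continuous fun x => fderiv ℝ u x e := fun e =>
    (hu.continuous_fderiv (by simp)).clm_apply continuous_const
  have hd2 : ∀ e f : Plane, Continuous fun x => fderiv ℝ (fun y => fderiv ℝ v y e) x f :=
    fun e f => ((hdv e).continuous_fderiv (by simp)).clm_apply continuous_const
  have hcd : ∀ e : Plane, HasCompactSupport fun x => fderiv ℝ φ x e := fun e => hc.fderiv_apply ℝ e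
  have hint : ∀ g : Plane → ℝ, Continuous g → HasCompactSupport g → Integrable g :=
    fun g hg hg' => hg.integrable_of_hasCompactSupport hg'
  have hsymm : ∀ x, fderiv ℝ (fun y => fderiv ℝ v y e) x f =
      fderiv ℝ (fun y => fderiv ℝ v y f) x e := fun x => by
    have h2 := (hv.contDiffAt (x := x)).isSymmSndFDerivAt (by simp)
    have hdd : DifferentiableAt ℝ (fderiv ℝ v) x :=
      (hv.fderiv_right (m := 1) (by norm_num)).differentiable (by simp) x
    have h3 : ∀ e f : Plane, fderiv ℝ (fun y => fderiv ℝ v y e) x f =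
        fderiv ℝ (fderiv ℝ v) x f e := fun e f => by
      rw [fderiv_clm_apply hdd (differentiableAt_const _)]
      simp
    rw [h3, h3]
    exact h2 f e
  -- One integration by parts. The terms with second derivatives of `v` cancel by symmetry when `key
  -- f e` is subtracted from `key e f`.
  have key : ∀ e f : Plane, ∫ x, φ x * (fderiv ℝ u x e * fderiv ℝ v x f) =
      - (∫ x, (u x - c) * fderiv ℝ φ x e * fderiv ℝ v x f)
        - ∫ x, (u x - c) * φ x * fderiv ℝ (fun y => fderiv ℝ v y f) x e := fun e f => by
    have hg : ContDiff ℝ 1 fun x => φ x * fderiv ℝ v x f := hφ.mul (hdv f)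
    have hgc : HasCompactSupport fun x => φ x * fderiv ℝ v x f := hc.mul_right
    have huc : ContDiff ℝ 1 fun x => u x - c := hu.sub contDiff_const
    have hfd : ∀ x, fderiv ℝ (fun x => u x - c) x e = fderiv ℝ u x e := fun x => by
      rw [fderiv_sub_const]
    have hfg : ∀ x, fderiv ℝ (fun x => φ x * fderiv ℝ v x f) x e =
        φ x * fderiv ℝ (fun y => fderiv ℝ v y f) x e + fderiv ℝ v x f * fderiv ℝ φ x e := fun x => by
      rw [fderiv_fun_mul (hφ.differentiable (by simp) x) ((hdv f).differentiable (by simp) x)]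
      simp
    have := integral_mul_fderiv_eq_neg_fderiv_mul_of_integrable (μ := volume)
      (f := fun x => φ x * fderiv ℝ v x f) (g := fun x => u x - c) (v := e)
      (hint _ (((hg.continuous_fderiv (by simp)).clm_apply continuous_const).mul
        huc.continuous) (hgc.fderiv_apply ℝ e).mul_right)
      (hint _ (hg.continuous.mul ((huc.continuous_fderiv (by simp)).clm_apply continuous_const))
        hgc.mul_right)
      (hint _ (hg.continuous.mul huc.continuous) hgc.mul_right)
      (fun x _ => hg.differentiable (by simp) x) (fun x _ => huc.differentiable (by simp) x)
    simp_rw [hfd, hfg] at this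
    rw [← integral_neg, ← integral_sub]
    · rw [← integral_neg] at this
      exact (integral_congr_ae (Eventually.of_forall fun x => by ring)).trans
        (this.trans (integral_congr_ae (Eventually.of_forall fun x => by dsimp only; ring)))
    · exact (hint _ ((huc.continuous.mul (hdφ e)).mul (hdv f).continuous)
        ((hcd e).mul_left.mul_right)).neg
    · exact hint _ ((huc.continuous.mul hφ.continuous).mul (hd2 f e)) (hc.mul_left.mul_right)
  simp_rw [mul_sub]
  rw [integral_sub, key e f, key f e]
  · simp_rw [hsymm]; ring
  · exact hint _ (hφ.continuous.mul ((hdu e).mul (hdv f).continuous)) hc.mul_right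
  · exact hint _ (hφ.continuous.mul ((hdu f).mul (hdv e).continuous)) hc.mul_right

theorem abs_integral_mul_le_of_setLIntegral_le {S : Set Plane} {ψ f : Plane → ℝ} {B M : ℝ}
    (hS : MeasurableSet S) (hB : 0 ≤ B) (hM : 0 ≤ M) (hψ : ∀ p ∈ S, |ψ p| ≤ B)
    (hψ0 : ∀ p ∉ S, ψ p = 0) (hf : ∫⁻ p in S, ‖f p‖ₑ ≤ ENNReal.ofReal M) :
    |∫ p, ψ p * f p| ≤ B * M := by
  rw [← Real.norm_eq_abs, ← ENNReal.ofReal_le_ofReal_iff (by positivity), ofReal_norm]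
  calc
    _ ≤ ∫⁻ p, ‖ψ p * f p‖ₑ := enorm_integral_le_lintegral_enorm _
    _ ≤ ∫⁻ p in S, ENNReal.ofReal B * ‖f p‖ₑ := by
      rw [← lintegral_indicator hS]
      refine lintegral_mono fun p => ?_
      by_cases hp : p ∈ S
      · rw [indicator_of_mem hp, enorm_mul, ← ofReal_norm (ψ p), Real.norm_eq_abs]
        gcongr
        exact hψ p hp
      · simp [hψ0 p hp]
    _ = ENNReal.ofReal B * ∫⁻ p in S, ‖f p‖ₑ := lintegral_const_mul' _ _ ENNReal.ofReal_ne_top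
    _ ≤ ENNReal.ofReal B * ENNReal.ofReal M := by gcongr
    _ = _ := (ENNReal.ofReal_mul hB).symm

/-- Quantitative continuity of the Jacobian near an affine map, tested against a cut-off function
between two concentric squares. -/
theorem abs_integral_mul_det_sub_le {L : Matrix (Fin 2) (Fin 2) ℝ} {w : Fin 2 → Plane → ℝ}
    (hw : ∀ i, ContDiff ℝ 2 (w i)) {x₀ : Plane} {a b : ℝ} (ha : 0 < a) (hab : a < b)
    {φ : Plane → ℝ} (hφ : ContDiff ℝ ∞ φ) (hφ0 : ∀ p, 0 ≤ φ p) (hφ1 : ∀ p, φ p ≤ 1)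
    (hφb : ∀ p ∉ square x₀ b, φ p = 0) {C : ℝ} (hC0 : 0 ≤ C)
    (hC : ∀ p (j : Fin 2), |fderiv ℝ φ p (EuclideanSpace.single j 1)| ≤ C / (b - a))
    (hφf : ∀ p ∉ squareFrame x₀ a b, fderiv ℝ φ p = 0)
    {Λ K M κ : ℝ} (hΛ0 : 0 ≤ Λ) (hΛ : ∀ i j, |L i j| ≤ Λ)
    (hK0 : 0 ≤ K) (hM0 : 0 ≤ M) (hκ0 : 0 ≤ κ)
    (hM : ∀ i j : Fin 2, ∫⁻ p in square x₀ b,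
      ‖fderiv ℝ (w i) p (EuclideanSpace.single j 1)‖ₑ ≤ ENNReal.ofReal M)
    (hK : ∀ i j : Fin 2, ∫⁻ p in squareFrame x₀ a b,
      ‖fderiv ℝ (w i) p (EuclideanSpace.single j 1)‖ₑ ≤ ENNReal.ofReal (K * (b - a)))
    (hκ : ∀ p ∈ square x₀ b, ∀ q ∈ square x₀ b, (∀ i, |p i - q i| ≤ b - a) →
      |w 0 p - w 0 q| ≤ κ) :
    |(∫ p, φ p * ((Matrix.of fun i j : Fin 2 =>
      L i j + fderiv ℝ (w i) p (EuclideanSpace.single j 1)).det)) - L.det * ∫ p, φ p| ≤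
      4 * Λ * M + 2 * C * K * (4 * κ + 2 * K) := by
  obtain ⟨c, hc⟩ := exists_abs_sub_le_of_mem_squareFrame ((hw 0).of_le (by norm_num)) ha hab hK0
    (hK 0) hκ
  have hs : 0 < b - a := sub_pos.2 hab
  have hφc : HasCompactSupport φ := HasCompactSupport.intro (isCompact_square x₀ b) hφb
  set D : Fin 2 → Fin 2 → Plane → ℝ := fun i j p =>
    fderiv ℝ (w i) p (EuclideanSpace.single j 1) with hD
  have hDc : ∀ i j, Continuous (D i j) := fun i j =>
    ((hw i).continuous_fderiv (by simp)).clm_apply continuous_const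
  have hφcont := hφ.continuous
  have hint : ∀ g : Plane → ℝ, Continuous g → Integrable fun p => φ p * g p := fun g hg =>
    (hφcont.mul hg).integrable_of_hasCompactSupport hφc.mul_right
  have hφint : Integrable φ := hφcont.integrable_of_hasCompactSupport hφc
  have hlin : ∀ i j, |∫ p, φ p * D i j p| ≤ M := fun i j => by
    simpa using abs_integral_mul_le_of_setLIntegral_le (isClosed_square x₀ b).measurableSet
      zero_le_one hM0 (fun p _ => by rw [abs_of_nonneg (hφ0 p)]; exact hφ1 p) hφb (hM i j)
  -- The gradient bound `C / (b - a)` and the mass bound `K * (b - a)` compensate: the width of the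
  -- frame disappears.
  have hquad : ∀ i j k, |∫ p, (w 0 p - c) * fderiv ℝ φ p (EuclideanSpace.single k 1) * D i j p| ≤
      C * K * (4 * κ + 2 * K) := fun i j k => by
    have := abs_integral_mul_le_of_setLIntegral_le (isClosed_squareFrame x₀ a b).measurableSet
      (ψ := fun p => (w 0 p - c) * fderiv ℝ φ p (EuclideanSpace.single k 1))
      (B := (4 * κ + 2 * K) * (C / (b - a))) (M := K * (b - a)) (by positivity) (by positivity)
      (fun p hp => by
        rw [abs_mul]
        exact mul_le_mul (hc p hp) (hC p k) (abs_nonneg _) (by positivity))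
      (fun p hp => by simp [hφf p hp]) (hK i j)
    refine this.trans_eq ?_
    field_simp
  have hjac := integral_mul_jacobian_eq (hφ.of_le (by simp)) hφc ((hw 0).of_le (by norm_num)) (hw 1) c
    (EuclideanSpace.single 0 1) (EuclideanSpace.single 1 1)
  have hsplit : (∫ p, φ p * ((Matrix.of fun i j : Fin 2 => L i j + D i j p).det)) =
      L.det * (∫ p, φ p) + L 0 0 * (∫ p, φ p * D 1 1 p) + L 1 1 * (∫ p, φ p * D 0 0 p)
        - L 0 1 * (∫ p, φ p * D 1 0 p) - L 1 0 * (∫ p, φ p * D 0 1 p)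
        + ∫ p, φ p * (D 0 0 p * D 1 1 p - D 0 1 p * D 1 0 p) := by
    have i0 := hφint.const_mul L.det
    have i1 := (hint _ (hDc 1 1)).const_mul (L 0 0)
    have i2 := (hint _ (hDc 0 0)).const_mul (L 1 1)
    have i3 := (hint _ (hDc 1 0)).const_mul (L 0 1)
    have i4 := (hint _ (hDc 0 1)).const_mul (L 1 0)
    have i5 := hint _ (((hDc 0 0).mul (hDc 1 1)).sub ((hDc 0 1).mul (hDc 1 0)))
    have hpt : ∀ p, φ p * (Matrix.of fun i j : Fin 2 => L i j + D i j p).det =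
        L.det * φ p + L 0 0 * (φ p * D 1 1 p) + L 1 1 * (φ p * D 0 0 p)
        - L 0 1 * (φ p * D 1 0 p) - L 1 0 * (φ p * D 0 1 p)
        + φ p * (D 0 0 p * D 1 1 p - D 0 1 p * D 1 0 p) := fun p => by
      simp only [Matrix.det_fin_two, Matrix.of_apply]
      ring
    simp_rw [hpt, ← integral_const_mul]
    rw [integral_add, integral_sub, integral_sub, integral_add, integral_add]
    · exact i0
    · exact i1
    · exact i0.add i1
    · exact i2
    · exact (i0.add i1).add i2
    · exact i3
    · exact ((i0.add i1).add i2).sub i3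
    · exact i4
    · exact (((i0.add i1).add i2).sub i3).sub i4
    · exact i5
  have hmul : ∀ i j i' j', |L i j * ∫ p, φ p * D i' j' p| ≤ Λ * M := fun i j i' j' => by
    rw [abs_mul]
    exact mul_le_mul (hΛ i j) (hlin i' j') (abs_nonneg _) hΛ0
  have q1 := abs_le.1 (hquad 1 0 1)
  have q2 := abs_le.1 (hquad 1 1 0)
  have m1 := abs_le.1 (hmul 0 0 1 1)
  have m2 := abs_le.1 (hmul 1 1 0 0)
  have m3 := abs_le.1 (hmul 0 1 1 0)
  have m4 := abs_le.1 (hmul 1 0 0 1)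
  rw [hsplit]
  simp only [hD] at *
  rw [hjac, abs_le]
  constructor <;> linarith [q1.1, q1.2, q2.1, q2.2, m1.1, m1.2, m2.1, m2.2, m3.1, m3.2, m4.1, m4.2]

/-! ### Squares, balls and the choice of a layer -/

theorem abs_apply_le_norm (p : Plane) (i : Fin 2) : |p i| ≤ ‖p‖ := by
  simpa using PiLp.norm_apply_le p i

theorem square_mono (x₀ : Plane) {b b' : ℝ} (h : b ≤ b') : square x₀ b ⊆ square x₀ b' :=
  fun _ hp i => (hp i).trans h

theorem closedBall_subset_square (x₀ : Plane) (r : ℝ) : closedBall x₀ r ⊆ square x₀ r :=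
  fun p hp i => by
    rw [mem_closedBall, dist_eq_norm] at hp
    exact (abs_apply_le_norm (p - x₀) i).trans hp

/-- The constant `3 / 2` is a rational substitute for `√2`. -/
theorem norm_le_of_forall_abs_le {p : Plane} {s : ℝ} (hs : 0 ≤ s) (h : ∀ i, |p i| ≤ s) :
    ‖p‖ ≤ 3 / 2 * s := by
  rw [EuclideanSpace.norm_eq, Fin.sum_univ_two]
  refine Real.sqrt_le_iff.2 ⟨by positivity, ?_⟩
  have h' : ∀ i, ‖p i‖ ^ 2 ≤ s ^ 2 := fun i => pow_le_pow_left₀ (norm_nonneg _) (h i) 2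
  nlinarith [h' 0, h' 1, sq_nonneg s]

theorem square_subset_closedBall {x₀ : Plane} {b r : ℝ} (hb : 0 ≤ b) (h : 3 / 2 * b ≤ r) :
    square x₀ b ⊆ closedBall x₀ r := fun p hp => by
  rw [mem_closedBall, dist_eq_norm]
  exact (norm_le_of_forall_abs_le hb fun i => hp i).trans h

theorem closedBall_subset_square_of_mem {x₀ x : Plane} {b ε : ℝ} (hx : x ∈ square x₀ b) :
    closedBall x ε ⊆ square x₀ (b + ε) := fun y hy i => by
  have h1 := closedBall_subset_square x ε hy i
  have h2 := hx i
  have h3 := abs_sub_le (y i) (x i) (x₀ i)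
  linarith

theorem closedBall_subset_diff_of_mem_squareFrame {x₀ x : Plane} {a b ε a' b' : ℝ}
    (hx : x ∈ squareFrame x₀ a b) (ha : a' < a - ε) (hb : b + ε ≤ b') :
    closedBall x ε ⊆ square x₀ b' \ square x₀ a' := fun y hy => by
  refine ⟨square_mono x₀ hb (closedBall_subset_square_of_mem hx.1 hy), fun hy' => ?_⟩
  obtain ⟨i, hi⟩ := hx.2
  have h1 := closedBall_subset_square x ε hy i
  have h2 := hy' i
  have h3 := abs_sub_le (x i) (y i) (x₀ i)
  rw [abs_sub_comm] at h1
  linarith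

/-- Among `N` consecutive layers of an increasing sequence of sets, one has at most the average
measure. -/
theorem exists_measure_diff_le {α : Type*} [MeasurableSpace α] (m : Measure α) {S : ℕ → Set α}
    (hS : ∀ n, MeasurableSet (S n)) (hmono : Monotone S) {N : ℕ} (hN : N ≠ 0) :
    ∃ k < N, m (S (k + 1) \ S k) ≤ m (S N) / N := by
  have hsum : ∀ n, ∑ k ∈ Finset.range n, m (S (k + 1) \ S k) ≤ m (S n) := fun n => by
    induction n with
    | zero => simp
    | succ n ih =>
      rw [Finset.sum_range_succ]
      calc
        _ ≤ m (S n) + m (S (n + 1) \ S n) := by gcongr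
        _ = m (S (n + 1)) := by
          rw [measure_add_sdiff (hS n).nullMeasurableSet, union_eq_self_of_subset_left
            (hmono n.le_succ)]
  by_contra! hcon
  refine (hsum N).not_gt ?_
  calc
    m (S N) = ∑ _k ∈ Finset.range N, m (S N) / N := by
      rw [Finset.sum_const, Finset.card_range, nsmul_eq_mul, ENNReal.mul_div_cancel
        (by exact_mod_cast hN) (ENNReal.natCast_ne_top N)]
    _ < _ := ENNReal.sum_lt_sum_of_nonempty (by simpa using hN)
      fun k hk => hcon k (Finset.mem_range.1 hk)

/-! ### The mollified map minus its linear part, in coordinates -/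

theorem continuousLinearMap_det_eq (T : Plane →L[ℝ] Plane) :
    T.det = (Matrix.of fun i j : Fin 2 => T (EuclideanSpace.single j 1) i).det := by
  rw [ContinuousLinearMap.det, ← LinearMap.det_toMatrix (EuclideanSpace.basisFun (Fin 2) ℝ).toBasis]
  congr 1

theorem fderiv_apply_coord {g : Plane → Plane} {x : Plane} (hg : DifferentiableAt ℝ g x) (v : Plane)
    (i : Fin 2) : fderiv ℝ g x v i = fderiv ℝ (fun y => g y i) x v := by
  have h := ((EuclideanSpace.proj i : Plane →L[ℝ] ℝ).hasFDerivAt (x := g x)).comp x hg.hasFDerivAt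
  have h' : HasFDerivAt (fun y => g y i) _ x := h
  rw [h'.fderiv]
  rfl

/-- The `i`-th component of the mollification of `h`, minus the linear map with matrix `L`. -/
def mollificationDefect (U : Opens Plane) (h : Plane → Plane) (L : Matrix (Fin 2) (Fin 2) ℝ)
    (ε : ℝ) (i : Fin 2) (p : Plane) : ℝ :=
  scalarMollification ε ((U : Set Plane).indicator fun y => h y i) p - ∑ j, L i j * p j

theorem integrableOn_coord {U : Opens Plane} {h : Plane → Plane}
    (hh : IntegrableOn h (U : Set Plane) volume) (i : Fin 2) :
    IntegrableOn (fun y => h y i) (U : Set Plane) volume :=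
  (EuclideanSpace.proj i : Plane →L[ℝ] ℝ).integrable_comp hh

theorem locallyIntegrable_indicator_coord {U : Opens Plane} {h : Plane → Plane}
    (hh : IntegrableOn h (U : Set Plane) volume) (i : Fin 2) :
    LocallyIntegrable ((U : Set Plane).indicator fun y => h y i) volume :=
  ((integrable_indicator_iff U.isOpen.measurableSet).2 (integrableOn_coord hh i)).locallyIntegrable

theorem contDiff_mollificationDefect {U : Opens Plane} {h : Plane → Plane}
    (hh : IntegrableOn h (U : Set Plane) volume) {L : Matrix (Fin 2) (Fin 2) ℝ}
    {ε : ℝ} (hε : 0 < ε) (i : Fin 2) :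
    ContDiff ℝ 2 (mollificationDefect U h L ε i) := by
  refine ((contDiff_scalarMollification hε (locallyIntegrable_indicator_coord hh i)).of_le
    (WithTop.coe_le_coe.2 (le_top : (2 : ℕ∞) ≤ ⊤))).sub
    (ContDiff.sum fun j _ => contDiff_const.mul ?_)
  exact (EuclideanSpace.proj j : Plane →L[ℝ] ℝ).contDiff

theorem fderiv_mollificationDefect {U : Opens Plane} {h : Plane → Plane}
    (hh : IntegrableOn h (U : Set Plane) volume) {L : Matrix (Fin 2) (Fin 2) ℝ}
    {ε : ℝ} (hε : 0 < ε) (i j : Fin 2) (p : Plane) :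
    fderiv ℝ (mollificationDefect U h L ε i) p (EuclideanSpace.single j 1) =
      fderiv ℝ (scalarMollification ε ((U : Set Plane).indicator fun y => h y i)) p
        (EuclideanSpace.single j 1) - L i j := by
  have h1 : HasFDerivAt (scalarMollification ε ((U : Set Plane).indicator fun y => h y i)) _ p :=
    ((contDiff_scalarMollification hε (locallyIntegrable_indicator_coord hh i)).differentiable
      (by simp) p).hasFDerivAt
  have h2 : HasFDerivAt (fun p : Plane => ∑ j, L i j * p j)
      (∑ j, L i j • (EuclideanSpace.proj j : Plane →L[ℝ] ℝ)) p :=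
    HasFDerivAt.fun_sum fun j _ =>
      ((EuclideanSpace.proj j : Plane →L[ℝ] ℝ).hasFDerivAt (x := p)).const_mul (L i j)
  have h3 : HasFDerivAt (mollificationDefect U h L ε i) _ p := h1.sub h2
  rw [h3.fderiv]
  fin_cases j <;> simp [Fin.sum_univ_two]

theorem det_fderiv_mollification {U : Opens Plane} {h : Plane → Plane}
    (hh : IntegrableOn h (U : Set Plane) volume) {L : Matrix (Fin 2) (Fin 2) ℝ}
    {ε : ℝ} (hε : 0 < ε) (p : Plane) :
    (fderiv ℝ (mollification U h ε) p).det = (Matrix.of fun i j : Fin 2 =>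
      L i j + fderiv ℝ (mollificationDefect U h L ε i) p (EuclideanSpace.single j 1)).det := by
  rw [continuousLinearMap_det_eq]
  congr 1
  ext i j
  simp only [Matrix.of_apply]
  rw [fderiv_mollificationDefect hh hε, fderiv_apply_coord
    ((contDiff_mollification hε hh).differentiable (by simp) p), add_sub_cancel]
  congr 2
  ext q
  exact mollification_apply hε hh q i

/-! ### Comparison at one scale, and passage to the limit -/

/-- The comparison of `det L` with the density `d` of the distributional Jacobian at one scale. -/
theorem exists_abs_sub_det_le : ∃ C : ℝ, 0 < C ∧
    ∀ {U : Opens Plane} {h : Plane → Plane}, IntegrableOn h (U : Set Plane) volume →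
    ContinuousOn h (U : Set Plane) →
    ∀ {L : Matrix (Fin 2) (Fin 2) ℝ} {d : ℝ} {ℓ : 𝓓(U, ℝ) → ℝ} {m : Measure Plane} [SFinite m],
    (∀ (i j : Fin 2) (φ : 𝓓(U, ℝ)), ‖(∫ x in (U : Set Plane), h x i *
      fderiv ℝ φ x (EuclideanSpace.single j 1)) + L i j * ∫ x, φ x‖ₑ ≤ ∫⁻ x, ‖φ x‖ₑ ∂m) →
    (∀ φ : 𝓓(U, ℝ), ‖ℓ φ - d * ∫ x, φ x‖ₑ ≤ ∫⁻ x, ‖φ x‖ₑ ∂m) →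
    (∀ φ : 𝓓(U, ℝ), Tendsto (fun ε : ℝ => ∫ x in (U : Set Plane),
      φ x * (fderiv ℝ (mollification U h ε) x).det) (𝓝[>] 0) (𝓝 (ℓ φ))) →
    ∀ {x₀ : Plane} {r η Λ : ℝ}, 0 < r → 0 < η → 0 ≤ Λ → (∀ i j, |L i j| ≤ Λ) →
    closedBall x₀ (4 * r) ⊆ (U : Set Plane) →
    m (closedBall x₀ (3 * r)) ≤ ENNReal.ofReal (η * r ^ 2) →
    |d - L.det| ≤ (1 + 4 * Λ) * η + C * η ^ 2 := by
  obtain ⟨C, hC0, hC⟩ := exists_cutoff_square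
  -- With `K = 3 η r` and `κ = 2 η r`, the quadratic error `2 C K (4 κ + 2 K)` equals `84 C η² r²`.
  refine ⟨84 * C, by positivity, ?_⟩
  intro U h hh hcont L d ℓ m _ hH hd hlim x₀ r η Λ hr hη hΛ0 hΛ hU hm
  obtain ⟨δ₀, hδ₀, hunif⟩ := Metric.uniformContinuousOn_iff.1
    ((isCompact_closedBall x₀ (4 * r)).uniformContinuousOn_of_continuous (hcont.mono hU))
    (η * r) (by positivity)
  -- The two summands make the layer width `3 s = r / N` smaller than `δ₀` and keep `Λ * (3 * s)` at
  -- most `η * r`.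
  obtain ⟨N, hN⟩ := exists_nat_gt (r / δ₀ + Λ / η)
  have hN0 : (0 : ℝ) < N := lt_of_le_of_lt (by positivity) hN
  have hN0' : N ≠ 0 := by exact_mod_cast hN0.ne'
  have hNδ : r / δ₀ < N := lt_of_le_of_lt (le_add_of_nonneg_right (by positivity)) hN
  have hNΛ : Λ / η < N := lt_of_le_of_lt (le_add_of_nonneg_left (by positivity)) hN
  -- Each layer has width `3 s`: its middle third will be the frame, and the outer thirds leave room
  -- for a mollifier of radius `ε < s`.
  set s : ℝ := r / (3 * N) with hs
  have hs0 : 0 < s := by positivity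
  have hNs : N * (3 * s) = r := by rw [hs]; field_simp
  have hsδ : 3 * s < δ₀ := by
    rw [div_lt_iff₀ hδ₀] at hNδ
    by_contra! hcon
    nlinarith
  have hsΛ : Λ * (3 * s) ≤ η * r := by
    rw [div_lt_iff₀ hη] at hNΛ
    rw [← hNs]
    nlinarith
  obtain ⟨k, hkN, hk⟩ := exists_measure_diff_le m (S := fun n : ℕ => square x₀ (r + n * (3 * s)))
    (fun n => (isClosed_square _ _).measurableSet)
    (fun n n' hn => square_mono x₀ (by gcongr)) hN0'
  set V := square x₀ (r + (k + 1 : ℕ) * (3 * s)) \ square x₀ (r + k * (3 * s)) with hV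
  have h2r : square x₀ (2 * r) ⊆ closedBall x₀ (3 * r) :=
    square_subset_closedBall (by positivity) (by linarith)
  have h2rU : square x₀ (2 * r) ⊆ U :=
    h2r.trans ((closedBall_subset_closedBall (by linarith)).trans hU)
  have hm2 : m (square x₀ (2 * r)) ≤ ENNReal.ofReal (η * r ^ 2) := (measure_mono h2r).trans hm
  have hk1 : r + (k + 1 : ℕ) * (3 * s) ≤ 2 * r := by
    have : ((k + 1 : ℕ) : ℝ) ≤ N := by exact_mod_cast hkN
    nlinarith
  have hk0 : 0 ≤ k * (3 * s) := by positivity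
  push_cast at hk1
  have hVm : MeasurableSet V :=
    (isClosed_square _ _).measurableSet.diff (isClosed_square _ _).measurableSet
  have hVU : V ⊆ U := fun x hx => h2rU (square_mono x₀ (by push_cast; exact hk1) hx.1)
  -- The average over the layers is `η r² / N`, and `r / N = 3 s`.
  have hmV : m V ≤ ENNReal.ofReal (3 * η * r * s) := by
    refine hk.trans ?_
    rw [hNs, ← two_mul]
    refine (ENNReal.div_le_div_right hm2 _).trans_eq ?_
    rw [← ENNReal.ofReal_natCast, ← ENNReal.ofReal_div_of_pos hN0]
    congr 1
    rw [hs]; field_simp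
  set a := r + k * (3 * s) + s with ha
  set b := r + k * (3 * s) + 2 * s with hb
  have hba : b - a = s := by rw [ha, hb]; ring
  have ha0 : 0 < a := by positivity
  have hab : a < b := by linarith
  obtain ⟨φ, hφ, hφ0, hφ1, hφa, hφb, hφd, hφf⟩ := hC x₀ a b ha0 hab
  have hbU : square x₀ b ⊆ square x₀ (2 * r) := square_mono x₀ (by linarith)
  let Φ : 𝓓(U, ℝ) :=
    { toFun := φ
      contDiff' := hφ
      hasCompactSupport' := HasCompactSupport.intro (isCompact_square x₀ b) hφb
      tsupport_subset' := by
        refine (closure_minimal (fun x hx => ?_) (isClosed_square x₀ b)).trans (hbU.trans h2rU)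
        by_contra hx'
        exact hx (hφb x hx') }
  have hΦ : ∀ x, Φ x = φ x := fun _ => rfl
  have hφU : ∀ x ∉ (U : Set Plane), φ x = 0 := fun x hx => hφb x fun h => hx (h2rU (hbU h))
  have hbound : ∀ ε : ℝ, 0 < ε → ε < s →
      |(∫ x in (U : Set Plane), φ x * (fderiv ℝ (mollification U h ε) x).det)
        - L.det * ∫ x, φ x| ≤
      4 * Λ * (η * r ^ 2) + 2 * C * (3 * η * r) * (4 * (2 * η * r) + 2 * (3 * η * r)) := by
    intro ε hε hεs
    rw [setIntegral_eq_integral_of_forall_compl_eq_zero fun x hx => by rw [hφU x hx, zero_mul]]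
    simp_rw [det_fderiv_mollification hh hε (L := L)]
    refine abs_integral_mul_det_sub_le (fun i => contDiff_mollificationDefect hh hε i) ha0 hab hφ
      hφ0 hφ1 hφb hC0.le hφd hφf hΛ0 hΛ (by positivity) (by positivity) (by positivity)
      (fun i j => ?_) (fun i j => ?_) ?_
    · simp_rw [fderiv_mollificationDefect hh hε]
      refine (setLIntegral_enorm_fderiv_scalarMollification_sub_le (integrableOn_coord hh i)
        (hH i j) hε (isClosed_square x₀ b).measurableSet
        (isClosed_square x₀ (2 * r)).measurableSet (fun x hx => ?_) h2rU).trans hm2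
      exact (closedBall_subset_square_of_mem hx).trans (square_mono x₀ (by linarith))
    · simp_rw [fderiv_mollificationDefect hh hε]
      rw [hba]
      refine (setLIntegral_enorm_fderiv_scalarMollification_sub_le (integrableOn_coord hh i)
        (hH i j) hε (isClosed_squareFrame x₀ a b).measurableSet hVm (fun x hx => ?_) hVU).trans hmV
      exact closedBall_subset_diff_of_mem_squareFrame hx (by linarith)
        (by push_cast; linarith)
    -- One `η r` comes from the uniform continuity of `h`, the other from the linear part, which
    -- varies by at most `2 Λ s`.
    · intro p hp q hq hpq
      rw [hba] at hpq
      have hmol : |scalarMollification ε ((U : Set Plane).indicator fun y => h y 0) p -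
          scalarMollification ε ((U : Set Plane).indicator fun y => h y 0) q| ≤ η * r := by
        refine abs_scalarMollification_sub_le hε (locallyIntegrable_indicator_coord hh 0)
          fun z hz => ?_
        have hmem : ∀ p ∈ square x₀ b, p - z ∈ closedBall x₀ (4 * r) := fun p hp => by
          have h1 := h2r (hbU hp)
          rw [mem_closedBall, dist_eq_norm] at h1 ⊢
          have h2 := norm_sub_le (p - x₀) z
          rw [sub_right_comm]
          nlinarith
        rw [indicator_of_mem (hU (hmem p hp)), indicator_of_mem (hU (hmem q hq))]
        have hdist : dist (p - z) (q - z) < δ₀ := by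
          rw [dist_sub_right, dist_eq_norm]
          have := norm_le_of_forall_abs_le (p := p - q) hs0.le hpq
          linarith
        have h3 := hunif _ (hmem p hp) _ (hmem q hq) hdist
        rw [dist_eq_norm] at h3
        exact (abs_apply_le_norm _ 0).trans h3.le
      have hl : ∀ j, |L 0 j * (p j - q j)| ≤ Λ * s := fun j => by
        rw [abs_mul]
        exact mul_le_mul (hΛ 0 j) (hpq j) (abs_nonneg _) hΛ0
      have l0 := abs_le.1 (hl 0)
      have l1 := abs_le.1 (hl 1)
      have hΛs : 0 ≤ Λ * s := by positivity
      rw [abs_le] at hmol ⊢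
      simp only [mollificationDefect, Fin.sum_univ_two]
      constructor <;> linarith [hmol.1, hmol.2, l0.1, l0.2, l1.1, l1.2]
  have hfin : |ℓ Φ - L.det * ∫ x, φ x| ≤
      4 * Λ * (η * r ^ 2) + 2 * C * (3 * η * r) * (4 * (2 * η * r) + 2 * (3 * η * r)) := by
    refine le_of_tendsto (((hlim Φ).sub_const _).abs) ?_
    filter_upwards [Ioo_mem_nhdsGT hs0] with ε hε using hbound ε hε.1 hε.2
  have hdens : |ℓ Φ - d * ∫ x, φ x| ≤ η * r ^ 2 := by
    rw [← Real.norm_eq_abs, ← ENNReal.ofReal_le_ofReal_iff (by positivity), ofReal_norm]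
    refine (hd Φ).trans (le_trans ?_ hm2)
    rw [← setLIntegral_one, ← lintegral_indicator (isClosed_square x₀ (2 * r)).measurableSet]
    refine lintegral_mono fun x => ?_
    rw [hΦ]
    by_cases hx : x ∈ square x₀ (2 * r)
    · rw [indicator_of_mem hx, ← ofReal_norm, Real.norm_of_nonneg (hφ0 x)]
      exact ENNReal.ofReal_le_one.2 (hφ1 x)
    · simp [hφb x fun h => hx (hbU h)]
  have hφint : Integrable φ := hφ.continuous.integrable_of_hasCompactSupport Φ.hasCompactSupport
  -- Here `φ = 1` on the disc of radius `r`, whose area is `π r²`.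
  have hφr : r ^ 2 ≤ ∫ x, φ x := by
    calc
      r ^ 2 ≤ volume.real (closedBall x₀ r) := by
        rw [Measure.real, EuclideanSpace.volume_closedBall_fin_two, ENNReal.toReal_mul,
          ENNReal.toReal_pow, ENNReal.toReal_ofReal hr.le, ENNReal.toReal_ofReal Real.pi_pos.le]
        nlinarith [Real.pi_gt_three, sq_nonneg r]
      _ = ∫ x in closedBall x₀ r, φ x := by
        rw [setIntegral_congr_fun measurableSet_closedBall (g := fun _ => (1 : ℝ)) fun x hx =>
          hφa x (square_mono x₀ (by linarith) (closedBall_subset_square x₀ r hx))]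
        simp
      _ ≤ ∫ x, φ x := setIntegral_le_integral hφint (Eventually.of_forall hφ0)
  have hmain : |d - L.det| * r ^ 2 ≤ ((1 + 4 * Λ) * η + 84 * C * η ^ 2) * r ^ 2 := by
    calc
      _ ≤ |d - L.det| * ∫ x, φ x := by gcongr
      _ = |(d - L.det) * ∫ x, φ x| := by
        rw [abs_mul, abs_of_nonneg (integral_nonneg hφ0)]
      _ = |(ℓ Φ - L.det * ∫ x, φ x) - (ℓ Φ - d * ∫ x, φ x)| := by congr 1; ring
      _ ≤ _ := (abs_sub _ _).trans (by linarith)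
  exact le_of_mul_le_mul_right hmain (by positivity)

theorem eq_det_of_tendsto_measure_closedBall_div {U : Opens Plane} {h : Plane → Plane}
    (hh : IntegrableOn h (U : Set Plane) volume) (hcont : ContinuousOn h (U : Set Plane))
    {L : Matrix (Fin 2) (Fin 2) ℝ} {d : ℝ} {ℓ : 𝓓(U, ℝ) → ℝ} {m : Measure Plane} [SFinite m]
    (hH : ∀ (i j : Fin 2) (φ : 𝓓(U, ℝ)), ‖(∫ x in (U : Set Plane), h x i *
      fderiv ℝ φ x (EuclideanSpace.single j 1)) + L i j * ∫ x, φ x‖ₑ ≤ ∫⁻ x, ‖φ x‖ₑ ∂m)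
    (hd : ∀ φ : 𝓓(U, ℝ), ‖ℓ φ - d * ∫ x, φ x‖ₑ ≤ ∫⁻ x, ‖φ x‖ₑ ∂m)
    (hlim : ∀ φ : 𝓓(U, ℝ), Tendsto (fun ε : ℝ => ∫ x in (U : Set Plane),
      φ x * (fderiv ℝ (mollification U h ε) x).det) (𝓝[>] 0) (𝓝 (ℓ φ)))
    {x₀ : Plane} (hx₀ : x₀ ∈ U)
    (hm : Tendsto (fun r => m (closedBall x₀ r) / volume (closedBall x₀ r)) (𝓝[>] 0) (𝓝 0)) :
    d = L.det := by
  obtain ⟨C, hC0, hC⟩ := exists_abs_sub_det_le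
  set Λ := ∑ i, ∑ j, |L i j| with hΛ
  have hΛ0 : 0 ≤ Λ := by positivity
  have hΛL : ∀ i j, |L i j| ≤ Λ := fun i j =>
    (Finset.single_le_sum (f := fun j => |L i j|) (fun _ _ => abs_nonneg _)
      (Finset.mem_univ j)).trans (Finset.single_le_sum (f := fun i => ∑ j, |L i j|)
        (fun _ _ => by positivity) (Finset.mem_univ i))
  have hη : ∀ η : ℝ, 0 < η → |d - L.det| ≤ (1 + 4 * Λ) * η + C * η ^ 2 := by
    intro η hη
    obtain ⟨R, hR0, hR⟩ := Metric.nhds_basis_closedBall.mem_iff.1 (U.isOpen.mem_nhds hx₀)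
    -- With `ρ = 3 r`, a mean density `η / (9 π)` on the disc of radius `ρ` is exactly the mass `η
    -- r²`.
    have hη' : (0 : ℝ≥0∞) < ENNReal.ofReal (η / (9 * Real.pi)) :=
      ENNReal.ofReal_pos.2 (by positivity)
    obtain ⟨ρ, ⟨hρ0, hρR⟩, hρ⟩ := ((show ∀ᶠ r : ℝ in 𝓝[>] 0, r ∈ Ioo 0 (R / 2) from
      Ioo_mem_nhdsGT (half_pos hR0)).and (hm.eventually (gt_mem_nhds hη'))).exists
    refine hC hh hcont hH hd hlim (x₀ := x₀) (r := ρ / 3) (by positivity) hη hΛ0 hΛL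
      ((closedBall_subset_closedBall (by linarith)).trans hR) ?_
    rw [mul_div_cancel₀ ρ three_ne_zero]
    have hvol : volume (closedBall x₀ ρ) = ENNReal.ofReal (ρ ^ 2 * Real.pi) := by
      rw [EuclideanSpace.volume_closedBall_fin_two, ← ENNReal.ofReal_pow hρ0.le,
        ← ENNReal.ofReal_mul (by positivity)]
    rw [hvol, ENNReal.div_lt_iff (Or.inl (by simpa using by positivity))
      (Or.inl ENNReal.ofReal_ne_top), ← ENNReal.ofReal_mul (by positivity)] at hρ
    refine hρ.le.trans_eq (congrArg _ ?_)
    field_simp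
    norm_num
  have hlim0 : Tendsto (fun η : ℝ => (1 + 4 * Λ) * η + C * η ^ 2) (𝓝[>] 0) (𝓝 0) := by
    have : Continuous fun η : ℝ => (1 + 4 * Λ) * η + C * η ^ 2 := by fun_prop
    simpa using (this.tendsto 0).mono_left nhdsWithin_le_nhds
  have h0 : |d - L.det| ≤ 0 := ge_of_tendsto hlim0 (by
    filter_upwards [self_mem_nhdsWithin] with η h using hη η h)
  exact sub_eq_zero.1 (abs_nonpos_iff.1 h0)

end

/-! ### Conclusion at almost every point -/

theorem theorem7p4 (U : Opens Plane) (h : Plane → Plane)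
    (hBV : MemBV U h) (hcont : ContinuousOn h (U : Set Plane))
    (μ : SignedMeasure Plane) (hμ : HasDistribJacobian U h μ) :
    ∀ᵐ x ∂(volume.restrict (U : Set Plane)),
      μ.rnDeriv volume x = pointwiseJacobian U h x := by
  have hae : ∀ᵐ x : Plane, ∀ i j : Fin 2, Tendsto (fun r =>
      deviationMeasure (derivMeasure U h i j) ((derivMeasure U h i j).rnDeriv volume x)
        (closedBall x r) / volume (closedBall x r)) (𝓝[>] 0) (𝓝 0) :=
    ae_all_iff.2 fun i => ae_all_iff.2 fun j => ae_tendsto_deviationMeasure_div _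
  rw [ae_restrict_iff' U.isOpen.measurableSet]
  filter_upwards [hae, ae_tendsto_deviationMeasure_div μ] with x hx hxμ hxU
  set L := approxGradient U h x with hL
  obtain ⟨D, hD⟩ : ∃ D : Fin 2 → Fin 2 → Measure Plane,
      ∀ i j, D i j = deviationMeasure (derivMeasure U h i j) (L i j) := ⟨_, fun _ _ => rfl⟩
  obtain ⟨D', hD'⟩ : ∃ D' : Measure Plane,
      D' = deviationMeasure μ (μ.rnDeriv volume x) := ⟨_, rfl⟩
  have hDs : ∀ i j, SFinite (D i j) := fun i j => by rw [hD]; infer_instance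
  have hDs' : SFinite D' := by rw [hD']; infer_instance
  -- A single measure dominating all five deviations, still of zero density at `x`.
  set m : Measure Plane := D' + D 0 0 + D 0 1 + D 1 0 + D 1 1 with hm
  have hDm : ∀ i j, D i j ≤ m := by
    simp only [Fin.forall_fin_two]
    exact ⟨⟨((Measure.le_add_left le_rfl).trans (Measure.le_add_right le_rfl)).trans
        ((Measure.le_add_right le_rfl).trans (Measure.le_add_right le_rfl)),
      (Measure.le_add_left le_rfl).trans
        ((Measure.le_add_right le_rfl).trans (Measure.le_add_right le_rfl))⟩,
      (Measure.le_add_left le_rfl).trans (Measure.le_add_right le_rfl), Measure.le_add_left le_rfl⟩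
  have hDm' : D' ≤ m :=
    ((Measure.le_add_right le_rfl).trans (Measure.le_add_right le_rfl)).trans
      ((Measure.le_add_right le_rfl).trans (Measure.le_add_right le_rfl))
  have hlim : Tendsto (fun r => m (closedBall x r) / volume (closedBall x r)) (𝓝[>] 0) (𝓝 0) := by
    have h1 : ∀ i j, Tendsto (fun r => D i j (closedBall x r) / volume (closedBall x r))
        (𝓝[>] 0) (𝓝 0) := fun i j => by rw [hD]; exact hx i j
    have h2 : Tendsto (fun r => D' (closedBall x r) / volume (closedBall x r))
        (𝓝[>] 0) (𝓝 0) := by rw [hD']; exact hxμ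
    have h3 := (((h2.add (h1 0 0)).add (h1 0 1)).add (h1 1 0)).add (h1 1 1)
    simp only [add_zero] at h3
    refine h3.congr fun r => ?_
    simp only [hm, Measure.add_apply, ENNReal.add_div]
  refine eq_det_of_tendsto_measure_closedBall_div (m := m) (L := L)
    (ℓ := fun φ => ∫ᵛ x, φ x ∂•μ) hBV.1 hcont (fun i j φ => ?_) (fun φ => ?_) hμ.2 hxU hlim
  · rw [(hBV.isPartialDerivMeasure i j).2 φ, neg_add_eq_sub, ← neg_sub, enorm_neg]
    refine (enorm_integral_sub_le_deviationMeasure _ _ φ.continuous φ.hasCompactSupport).trans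
      (lintegral_mono' ?_ le_rfl)
    rw [← hD]
    exact hDm i j
  · refine (enorm_integral_sub_le_deviationMeasure _ _ φ.continuous φ.hasCompactSupport).trans
      (lintegral_mono' ?_ le_rfl)
    rw [← hD']
    exact hDm'
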